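/- Let $K$ be an algebraically closed field of characteristic zero, and let $S\subset\mathbf P^3$ be a Delsarte surface, i.e. the zero set of a homogeneous polynomial $F=\sum_{i=1}^4 c_i\prod_{j=0}^3 X_j^{a_{ij}}$ with $c_i\in K^*$, $a_{ij}\in\mathbf Z_{\ge 0}$, such that $\det(a_{ij})\neq 0$ and the affine equation $f(x,y,t)=F(x,y,t,1)$ has the form $m_1+m_2+m_3+t\,m_4$, where $m_1,\dots,m_4$ are monomials in $x$ and $y$ (with coefficient $1$). Consider the standard fibration $S\dashrightarrow\mathbf P^1$, $(X_0:X_1:X_2:X_3)\mapsto (X_2:X_3)$, in affine coordinates $(x,y,t)\mapsto t$. Assume that its generic fiber is irreducible and has positive geometric genus. Let $K(S)=K(x,y,t)/(f)$ be the function field of $S$. Then at least one of the following holds. (a) $m_4$ is equal to one of $m_1,m_2,m_3$, and the fibration is isotrivial: after a finite extension of $K(t)$ it becomes birational to a product $C\times B\to B$ with a curve $C$ over $K$. (b) There are an integer $a\geq 1$ and pairwise distinct integers $b,c,d\ge 0$ such that $S$ is Delsarte-birational, over the $t$-line, to the Delsarte surface with affine equation $y^a=f_1(x,t)$, where $f_1(x,t)=-(x^b+x^c+t\,x^d)$;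 that is, there is a birational monomial map $\mathbf P^3\dashrightarrow\mathbf P^3$ that leaves the coordinate $t$ fixed and takes $S$ to this surface. (c) Every singular fiber over a point $t=t_0$ with $t_0\neq 0,\infty$ is semistable, i.e. reduced with only ordinary double points (Milnor number $1$). More precisely, there is a regular surface $X$ with function field $K(S)$ and a proper morphism $X\to \mathbf P^1\setminus\{0,\infty\}$ given by $t$ such that $(x:y:1)$ defines a morphism $X\to\mathbf P^2$ (so that $X$ is a resolution of the family of plane curves defined by $f$) and such that every closed fiber of $X\to \mathbf P^1\setminus\{0,\infty\}$ is reduced and has no singularities other than ordinary double points. -/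

import Mathlib

noncomputable section

open MvPolynomial IsLocalRing
open scoped KaehlerDifferential

universe u v

/-! ### Delsarte surfaces and their standard fibration -/

/-- A Delsarte surface in `ℙ³`: the zero set of a homogeneous polynomial
`∑ i, c i * ∏ j, X j ^ A i j` with four terms. -/
structure DelsarteSurface (K : Type u) [Field K] where
  /-- the coefficients `c i` -/
  coeff : Fin 4 → K
  coeff_ne_zero : ∀ i, coeff i ≠ 0
  /-- the exponent matrix `A` -/
  exponent : Matrix (Fin 4) (Fin 4) ℕ
  /-- the common degree of the four monomials -/
  degree : ℕ
  row_sum : ∀ i, ∑ j, exponent i j = degree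

namespace DelsarteSurface

variable {K : Type u} [Field K]

/-- The homogeneous equation `F` of the surface. -/
def equation (S : DelsarteSurface K) : MvPolynomial (Fin 4) K :=
  ∑ i, C (S.coeff i) * ∏ j, X j ^ S.exponent i j

/-- The affine equation `f(x, y, t) = F(x, y, t, 1)`; the variables `0, 1, 2` are `x, y, t`.
The standard fibration on the surface is the projection to the coordinate `t`. -/
def affineEquation (S : DelsarteSurface K) : MvPolynomial (Fin 3) K :=
  aeval ![X 0, X 1, X 2, 1] S.equation

/-- The exponents of `x` and `y` in the `i`-th monomial, i.e. the monomial `m i` in `x` and `y`. -/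
def xyExponent (S : DelsarteSurface K) (i : Fin 4) : ℕ × ℕ :=
  (S.exponent i 0, S.exponent i 1)

/-- The standard fibration is minimal: the affine equation is `m₁ + m₂ + m₃ + t * m₄` with
monomials `mᵢ` in `x` and `y` (the terms being listed in this order), and `det A ≠ 0`. -/
structure IsMinimal (S : DelsarteSurface K) : Prop where
  coeff_eq_one : ∀ i, S.coeff i = 1
  t_exponent : ∀ i, S.exponent i 2 = if i = 3 then 1 else 0
  det_ne_zero : (S.exponent.map (Nat.cast : ℕ → ℤ)).det ≠ 0

/-- The field `L`, with the elements `x, y, t`, is the function field `K(x, y, t)/(f)` of the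
surface.  As the kernel of a map to a field is prime, this contains that `f` is irreducible. -/
structure IsFunctionField (S : DelsarteSurface K) {L : Type v} [Field L] [Algebra K L]
    (x y t : L) : Prop where
  ker_eq : RingHom.ker (aeval ![x, y, t] : MvPolynomial (Fin 3) K →ₐ[K] L)
    = Ideal.span {S.affineEquation}
  adjoin_eq_top : IntermediateField.adjoin K {x, y, t} = ⊤

/-- The monomial map `(x, y, t) ↦ (∏ⱼ pⱼ ^ M₀ⱼ, ∏ⱼ pⱼ ^ M₁ⱼ, ∏ⱼ pⱼ ^ M₂ⱼ)` on the torus. -/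
def monomialMap (M : Matrix (Fin 3) (Fin 3) ℤ) (p : Fin 3 → Kˣ) : Fin 3 → Kˣ :=
  fun i => ∏ j, p j ^ M i j

/-- There is a birational monomial map of `ℙ³` (in affine coordinates: a monomial map given by an
invertible integral matrix) that commutes with the projection to `t` and takes `S` to `S'`.
Birational monomial maps are isomorphisms on the torus, so the last condition is tested there. -/
def IsDelsarteBirational (S S' : DelsarteSurface K) : Prop :=
  ∃ M : Matrix (Fin 3) (Fin 3) ℤ, IsUnit M.det ∧ M 2 = ![0, 0, 1] ∧
    ∀ p : Fin 3 → Kˣ,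
      eval (fun i => (p i : K)) S.affineEquation = 0 ↔
        eval (fun i => (monomialMap M p i : K)) S'.affineEquation = 0

end DelsarteSurface

/-! ### The geometric genus of a function field -/

section Genus

variable (k : Type u) (L : Type v) [Field k] [Field L] [Algebra k L]

/-- The differentials of `L/k` that are regular at every place of `L/k`: for every valuation ring
`O` of `L` that contains `k` they lie in the `O`-module generated by the `da`, `a ∈ O`. -/
def regularDifferentials : Submodule k Ω[L⁄k] where
  carrier := {ω | ∀ O : ValuationSubring L, (∀ c : k, algebraMap k L c ∈ O) →
    ω ∈ Submodule.span O (Set.range fun a : O => KaehlerDifferential.D k L (a : L))}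
  add_mem' := fun ha hb O hO => Submodule.add_mem _ (ha O hO) (hb O hO)
  zero_mem' := fun _ _ => Submodule.zero_mem _
  smul_mem' := by
    intro c ω hω O hO
    have h := Submodule.smul_mem _ (⟨algebraMap k L c, hO c⟩ : O) (hω O hO)
    have e : (⟨algebraMap k L c, hO c⟩ : O) • ω = c • ω :=
      algebraMap_smul L c ω
    rwa [e] at h

/-- The geometric genus of a curve over `k` with function field `L`: the dimension of the space
of regular differentials on its regular projective model. -/
def geometricGenus : ℕ := Module.finrank k (regularDifferentials k L)

end Genus

/-! ### Isotriviality -/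

/-- The fibration with function field extension `L/K(t)` is isotrivial: after a finite extension
`B` of `K(t)` it becomes birational to a product, i.e. the compositum of `L` and `B` is the
compositum of `B` with the function field `C` of a curve over `K`. -/
def IsIsotrivial (K : Type u) {L : Type v} [Field K] [Field L] [Algebra K L] (t : L) : Prop :=
  ∃ (B C : IntermediateField K (AlgebraicClosure L))
    (h : IntermediateField.adjoin K {algebraMap L (AlgebraicClosure L) t} ≤ B),
    FiniteDimensional (IntermediateField.adjoin K {algebraMap L (AlgebraicClosure L) t})
      (IntermediateField.extendScalars h) ∧
    C.FG ∧ Algebra.trdeg K C = 1 ∧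
    (IsScalarTower.toAlgHom K L (AlgebraicClosure L)).fieldRange ⊔ B = C ⊔ B

/-! ### Models of the fibration and their fibers -/

section Model

variable {K : Type u} {L : Type v} [Field K] [Field L] [Algebra K L]

/-- The local ring of the affine model `A` at the center of the valuation ring `O ⊇ A`, as a
subset of `L`. -/
def localRingAtCenter (A : Subalgebra K L) (O : ValuationSubring L) : Set L :=
  {z | ∃ a ∈ A, ∃ b ∈ A, O.valuation b = 1 ∧ z = a / b}

/-- The affine models `Spec (A i)` of `L` are the charts of a model of `L` that is proper over
`Spec K[t, t⁻¹] = ℙ¹ ∖ {0, ∞}` (a complete model in the sense of Zariski): every valuation ring of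
`L` that contains `K[t, t⁻¹]` has a center on the model, and only one. -/
structure IsProperModel (t : L) {n : ℕ} (A : Fin n → Subalgebra K L) : Prop where
  base_le : ∀ i, Algebra.adjoin K {t, t⁻¹} ≤ A i
  fg : ∀ i, (A i).FG
  isFractionRing : ∀ i, IsFractionRing (A i) L
  exists_center : ∀ O : ValuationSubring L,
    (∀ z ∈ Algebra.adjoin K {t, t⁻¹}, z ∈ O) → ∃ i, ∀ z ∈ A i, z ∈ O
  center_unique : ∀ O : ValuationSubring L, ∀ i j,
    (∀ z ∈ A i, z ∈ O) → (∀ z ∈ A j, z ∈ O) →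
      localRingAtCenter (A i) O = localRingAtCenter (A j) O

/-- The coordinates `(x : y : 1)` define a morphism from the model to `ℙ²`: every chart is mapped
into one of the three standard affine charts.  So the model maps to the family over
`ℙ¹ ∖ {0, ∞}` of plane curves that is cut out by the equation of the surface. -/
def MapsToPlaneCurves (x y : L) {n : ℕ} (A : Fin n → Subalgebra K L) : Prop :=
  ∀ i, (x ∈ A i ∧ y ∈ A i) ∨ (x⁻¹ ∈ A i ∧ y * x⁻¹ ∈ A i) ∨ (y⁻¹ ∈ A i ∧ x * y⁻¹ ∈ A i)

/-- For the two-dimensional local ring `R` of a surface at a closed point: `R` is regular and the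
curve `s = 0` is smooth at the point, i.e. `s` is part of a system of two parameters. -/
def IsSmoothPointOfFiber {R : Type v} [CommRing R] [IsLocalRing R] (s : R) : Prop :=
  ∃ u : R, maximalIdeal R = Ideal.span {s, u}

/-- For the two-dimensional local ring `R` of a surface at a closed point: `R` is regular and the
curve `s = 0` has an ordinary double point, i.e. `s = u * v` up to terms of order three in suitable
parameters `u, v` (over an algebraically closed field of characteristic zero this says that the
quadratic part of `s` is nondegenerate, or that the Milnor number is one). -/
def IsOrdinaryDoublePointOfFiber {R : Type v} [CommRing R] [IsLocalRing R] (s : R) : Prop :=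
  ∃ u v : R, maximalIdeal R = Ideal.span {u, v} ∧ s - u * v ∈ maximalIdeal R ^ 3

/-- The fiber over `t₀` of the model with charts `A i` is smooth or semistable: at each of its
closed points the model is regular and the fiber `t - t₀ = 0` is smooth or has an ordinary double
point. -/
def HasSemistableFiber (t : L) {n : ℕ} (A : Fin n → Subalgebra K L) (t₀ : K) : Prop :=
  ∀ (i : Fin n) (p : Ideal (A i)) [p.IsMaximal] (s : A i),
    (s : L) = t - algebraMap K L t₀ → s ∈ p →
      IsSmoothPointOfFiber (algebraMap (A i) (Localization.AtPrime p) s) ∨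
      IsOrdinaryDoublePointOfFiber (algebraMap (A i) (Localization.AtPrime p) s)

end Model

end

noncomputable section

open MvPolynomial IsLocalRing

universe u v

/-! ### Semistability at a point, in local coordinates -/

section LocalAlgebra

/-! The exponents of m₁, …, m₄ are four points of ℤ². By homogeneity, det A is up to sign the degree
times twice the area of the triangle of the first three (`latticeCross_ne_zero`), so this triangle
is nondegenerate. The three alternatives are the possible positions of the fourth point.

If it is a vertex, the equation reads (1 + t) mᵢ + mⱼ + mₖ = 0. Some integral weight takes equal
values on mⱼ and mₖ and a value larger by n on mᵢ, so rescaling x and y by powers of an n-th root of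
1 + t removes t from the equation (`isIsotrivial`).

If it lies on a line through two vertices but is not a vertex, a lattice basis adapted to that line
(`exists_adapted_basis`) turns the three collinear monomials into powers of one coordinate and the
remaining one into a power of the other, up to a common monomial factor.

Otherwise no three points are collinear, and a toric modification gives the model
(`exists_semistable_model`). The corners of the three charts of the plane are blown up until on each
chart one monomial divides the others (`exists_refinement`); dividing by it gives an equation with a
unit constant term. At a closed point over t₀ ≠ 0 the maximal ideal is generated by t - t₀ and two
shifted coordinates, and the equation makes one generator redundant; this gives regularity and the
shape of the fiber at once (`isSmooth_or_isOrdinaryDoublePoint`). Corners are not on the surface. On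
a boundary curve at most two monomials survive, and a binomial has only simple nonzero roots, so the
fiber is smooth. In the torus, a singular point makes the values of the four terms a mass
distribution on the four exponents with zero total mass and zero first moments. The Hessian is its
second moment form, nondegenerate because the points are in general position
(`moment_discriminant_ne_zero`), so the singularity is an ordinary double point. -/

/-- Twice the oriented area of the lattice triangle `a b c`. -/
def latticeCross (a b c : ℤ × ℤ) : ℤ := (a.1 - c.1) * (b.2 - c.2) - (b.1 - c.1) * (a.2 - c.2)

/-- No three of the four lattice points are collinear. -/
def InGeneralPosition (e : Fin 4 → ℤ × ℤ) : Prop :=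
  ∀ i j k, i ≠ j → i ≠ k → j ≠ k → latticeCross (e i) (e j) (e k) ≠ 0

theorem exists_fin_four_ne (i j : Fin 4) : ∃ k, k ≠ i ∧ k ≠ j := by decide +revert

/-- Binomial expansion to second order, doubled so that the coefficient n(n - 1)/2 needs no
division. -/
theorem two_mul_one_add_pow {R : Type*} [CommRing R] (X : R) (n : ℕ) :
    ∃ w, 2 * (1 + X) ^ n = 2 + 2 * n * X + ((n : R) ^ 2 - n) * X ^ 2 + X ^ 3 * w := by
  induction n with
  | zero => exact ⟨0, by simp⟩
  | succ n ih =>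
    obtain ⟨w, hw⟩ := ih
    refine ⟨(n : R) ^ 2 - n + w * (1 + X), ?_⟩
    rw [pow_succ, ← mul_assoc, hw]
    push_cast
    ring

theorem exists_add_pow_linear {R : Type*} [CommRing R] (x y : R) (n : ℕ) :
    ∃ w, (x + y) ^ n = x ^ n + n * x ^ (n - 1) * y + y ^ 2 * w := by
  obtain ⟨w, hw⟩ := Polynomial.powAddExpansion x y n
  exact ⟨w, by rw [hw]; ring⟩

/-- A nondegenerate binary quadratic form over an algebraically closed field is the product of two
independent linear forms. -/
theorem exists_factor_quadratic {K : Type*} [Field K] [IsAlgClosed K] [CharZero K] (A B C : K)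
    (h : A * C - B ^ 2 ≠ 0) :
    ∃ a b c d : K, a * d - b * c ≠ 0 ∧ A = a * c ∧ 2 * B = a * d + b * c ∧ C = b * d := by
  by_cases hA : A = 0
  · subst hA
    refine ⟨0, 1, 2 * B, C, ?_, by simp, by simp, by simp⟩
    intro h'
    apply h
    have : B = 0 := by simpa using h'
    simp [this]
  -- Quadratic formula: with δ² = B² - AC, A times the form is (AX + (B + δ)Y)(AX + (B - δ)Y).
  · obtain ⟨δ, hδ⟩ := IsAlgClosed.exists_pow_nat_eq (-(A * C - B ^ 2)) (n := 2) (by norm_num)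
    have hδ0 : δ ≠ 0 := by
      rintro rfl
      apply h
      linear_combination hδ
    refine ⟨A, B + δ, 1, (B - δ) / A, ?_, by simp, ?_, ?_⟩
    · rw [mul_div_cancel₀ _ hA]
      intro h'
      apply hδ0
      have : (2 : K) * δ = 0 := by linear_combination -h'
      simpa using this
    · rw [mul_div_cancel₀ _ hA]; ring
    · field_simp
      linear_combination hδ

/-- The second moments of a weighted configuration of four points in general position, of total
mass zero and with vanishing first moments, form a nondegenerate quadratic form. -/
theorem moment_discriminant_ne_zero {K : Type*} [Field K] (M p q : Fin 4 → K)
    (hM : ∀ j, M j ≠ 0) (h0 : ∑ j, M j = 0) (h1 : ∑ j, M j * p j = 0) (h2 : ∑ j, M j * q j = 0)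
    (hc : (p 0 - p 2) * (q 1 - q 2) - (p 1 - p 2) * (q 0 - q 2) ≠ 0) :
    (∑ j, M j * p j ^ 2) * (∑ j, M j * q j ^ 2) - (∑ j, M j * (p j * q j)) ^ 2 ≠ 0 := by
  -- The fourth point is the centroid of the first three masses, so the second moments are their
  -- central moments, whose determinant is M₀M₁M₂ / (M₀ + M₁ + M₂) times the squared area term.
  have key : M 3 * ((∑ j, M j * p j ^ 2) * (∑ j, M j * q j ^ 2) - (∑ j, M j * (p j * q j)) ^ 2)
      = -(M 0 * M 1 * M 2 * ((p 0 - p 2) * (q 1 - q 2) - (p 1 - p 2) * (q 0 - q 2)) ^ 2) := by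
    simp only [Fin.sum_univ_four] at *
    have e0 : M 3 = -(M 0 + M 1 + M 2) := by linear_combination h0
    have e1 : M 3 * p 3 = -(M 0 * p 0 + M 1 * p 1 + M 2 * p 2) := by linear_combination h1
    have e2 : M 3 * q 3 = -(M 0 * q 0 + M 1 * q 1 + M 2 * q 2) := by linear_combination h2
    apply mul_left_cancel₀ (hM 3)
    have E1 : M 3 * (M 0 * p 0 ^ 2 + M 1 * p 1 ^ 2 + M 2 * p 2 ^ 2 + M 3 * p 3 ^ 2)
        = -(M 0 + M 1 + M 2) * (M 0 * p 0 ^ 2 + M 1 * p 1 ^ 2 + M 2 * p 2 ^ 2)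
          + (M 0 * p 0 + M 1 * p 1 + M 2 * p 2) ^ 2 := by
      rw [← e0]; linear_combination (M 3 * p 3 - (M 0 * p 0 + M 1 * p 1 + M 2 * p 2)) * e1
    have E2 : M 3 * (M 0 * q 0 ^ 2 + M 1 * q 1 ^ 2 + M 2 * q 2 ^ 2 + M 3 * q 3 ^ 2)
        = -(M 0 + M 1 + M 2) * (M 0 * q 0 ^ 2 + M 1 * q 1 ^ 2 + M 2 * q 2 ^ 2)
          + (M 0 * q 0 + M 1 * q 1 + M 2 * q 2) ^ 2 := by
      rw [← e0]; linear_combination (M 3 * q 3 - (M 0 * q 0 + M 1 * q 1 + M 2 * q 2)) * e2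
    have E3 : M 3 * (M 0 * (p 0 * q 0) + M 1 * (p 1 * q 1) + M 2 * (p 2 * q 2) + M 3 * (p 3 * q 3))
        = -(M 0 + M 1 + M 2) * (M 0 * (p 0 * q 0) + M 1 * (p 1 * q 1) + M 2 * (p 2 * q 2))
          + (M 0 * p 0 + M 1 * p 1 + M 2 * p 2) * (M 0 * q 0 + M 1 * q 1 + M 2 * q 2) := by
      rw [← e0]
      linear_combination (M 3 * q 3) * e1 - (M 0 * p 0 + M 1 * p 1 + M 2 * p 2) * e2
    generalize hA : M 0 * p 0 ^ 2 + M 1 * p 1 ^ 2 + M 2 * p 2 ^ 2 + M 3 * p 3 ^ 2 = A at *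
    generalize hB : M 0 * (p 0 * q 0) + M 1 * (p 1 * q 1) + M 2 * (p 2 * q 2)
      + M 3 * (p 3 * q 3) = B at *
    generalize hC : M 0 * q 0 ^ 2 + M 1 * q 1 ^ 2 + M 2 * q 2 ^ 2 + M 3 * q 3 ^ 2 = C at *
    have : M 3 * (M 3 * (A * C - B ^ 2)) = (M 3 * A) * (M 3 * C) - (M 3 * B) ^ 2 := by ring
    rw [this, E1, E2, E3, e0]
    ring
  intro h
  rw [h, mul_zero, eq_comm, neg_eq_zero] at key
  simp [hM, hc] at key

theorem mem_ideal_of_algebraMap_mul_mem {K R : Type*} [Field K] [CommRing R] [Algebra K R]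
    {I : Ideal R} {c : K} (hc : c ≠ 0) {r : R}
    (h : algebraMap K R c * r ∈ I) : r ∈ I := by
  have := I.mul_mem_left (algebraMap K R c⁻¹) h
  rwa [← mul_assoc, ← map_mul, inv_mul_cancel₀ hc, map_one, one_mul] at this

variable {K : Type u} [Field K] {R : Type v} [CommRing R] [IsLocalRing R] [Algebra K R]

theorem eq_zero_of_algebraMap_mem_maximalIdeal {c : K}
    (h : algebraMap K R c ∈ maximalIdeal R) : c = 0 := by
  by_contra hc
  exact ((mem_maximalIdeal _).1 h) ((IsUnit.mk0 c hc).map (algebraMap K R))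

theorem isUnit_of_sub_mem_maximalIdeal {c : K} (hc : c ≠ 0) {r : R}
    (h : r - algebraMap K R c ∈ maximalIdeal R) : IsUnit r := by
  by_contra hr
  have : algebraMap K R c ∈ maximalIdeal R := by
    have := Ideal.sub_mem _ ((mem_maximalIdeal _).2 hr) h
    simpa using this
  exact hc (eq_zero_of_algebraMap_mem_maximalIdeal this)

/-- Nakayama's lemma: generators of the maximal ideal may be checked modulo its square. -/
theorem maximalIdeal_eq_span_pair {s X Y a b : R} (hm : maximalIdeal R = Ideal.span {s, X, Y})
    (ha : a ∈ maximalIdeal R) (hb : b ∈ maximalIdeal R)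
    (hs : s ∈ Ideal.span {a, b} ⊔ maximalIdeal R ^ 2)
    (hX : X ∈ Ideal.span {a, b} ⊔ maximalIdeal R ^ 2)
    (hY : Y ∈ Ideal.span {a, b} ⊔ maximalIdeal R ^ 2) :
    maximalIdeal R = Ideal.span {a, b} := by
  apply le_antisymm
  · apply Submodule.le_of_le_smul_of_le_jacobson_bot (I := maximalIdeal R)
    · rw [hm]
      exact Submodule.fg_span (by simp)
    · exact (IsLocalRing.jacobson_eq_maximalIdeal ⊥ bot_ne_top).ge
    · rw [smul_eq_mul, ← pow_two]
      conv_lhs => rw [hm]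
      rw [Ideal.span_le]
      rintro z (rfl | rfl | rfl) <;> assumption
  · rw [Ideal.span_le]
    rintro z (rfl | rfl) <;> assumption

/-- If the equation has nonzero derivative in the direction of `X`, the fiber is smooth. -/
theorem isSmoothPointOfFiber_of_linear {s X Y : R} (hm : maximalIdeal R = Ideal.span {s, X, Y})
    {c : K} (hc : c ≠ 0)
    (h : algebraMap K R c * X ∈ Ideal.span {s, Y} ⊔ maximalIdeal R ^ 2) :
    IsSmoothPointOfFiber s := by
  refine ⟨Y, maximalIdeal_eq_span_pair hm ?_ ?_ ?_ (mem_ideal_of_algebraMap_mul_mem hc h) ?_⟩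
  · rw [hm]; exact Ideal.subset_span (by simp)
  · rw [hm]; exact Ideal.subset_span (by simp)
  · exact Ideal.mem_sup_left (Ideal.subset_span (by simp))
  · exact Ideal.mem_sup_left (Ideal.subset_span (by simp))

/-- Product of two doubled expansions, hence the factor 4. The quadratic part is split into (pX +
qY)², which sums to second moments, and a rest that is linear in p and q, which cancels when the
first moments vanish. -/
theorem one_add_pow_mul_one_add_pow_mem {R : Type*} [CommRing R] (I : Ideal R) {X Y : R}
    (hX : X ∈ I) (hY : Y ∈ I) (p q : ℕ) :
    4 * ((1 + X) ^ p * (1 + Y) ^ q) - 2 * (2 + 2 * p * X + 2 * q * Y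
      + (p ^ 2 * X ^ 2 + 2 * (p * q) * (X * Y) + q ^ 2 * Y ^ 2) - p * X ^ 2 - q * Y ^ 2)
      ∈ I ^ 3 := by
  obtain ⟨w, hw⟩ := two_mul_one_add_pow X p
  obtain ⟨z, hz⟩ := two_mul_one_add_pow Y q
  have e : (4 : R) * ((1 + X) ^ p * (1 + Y) ^ q) = (2 * (1 + X) ^ p) * (2 * (1 + Y) ^ q) := by ring
  have h1 : X * X * X ∈ I * I * I := Ideal.mul_mem_mul (Ideal.mul_mem_mul hX hX) hX
  have h2 : X * X * Y ∈ I * I * I := Ideal.mul_mem_mul (Ideal.mul_mem_mul hX hX) hY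
  have h3 : X * Y * Y ∈ I * I * I := Ideal.mul_mem_mul (Ideal.mul_mem_mul hX hY) hY
  have h4 : Y * Y * Y ∈ I * I * I := Ideal.mul_mem_mul (Ideal.mul_mem_mul hY hY) hY
  have e3 : I ^ 3 = I * I * I := by rw [pow_succ, pow_two]
  rw [e, hw, hz, e3]
  set a : R := (p : R) ^ 2 - p with ha
  set b : R := (q : R) ^ 2 - q with hb
  have := Ideal.add_mem _ (Ideal.add_mem _ (Ideal.mul_mem_right
      (w * (2 + 2 * q * Y + b * Y ^ 2 + Y ^ 3 * z)) _ h1)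
      (Ideal.mul_mem_right (z * (2 + 2 * p * X + a * X ^ 2)) _ h4))
      (Ideal.add_mem _ (Ideal.mul_mem_right (2 * p * b) _ h3)
      (Ideal.mul_mem_right (2 * q * a + a * b * Y) _ h2))
  convert this using 1
  simp only [ha, hb]
  ring

/-- At a point of the torus the fiber is smooth or has an ordinary double point. -/
theorem isSmooth_or_isOrdinaryDoublePoint_of_torus [IsAlgClosed K] [CharZero K] {s X Y : R}
    (hm : maximalIdeal R = Ideal.span {s, X, Y}) (M : Fin 4 → K) (hM : ∀ j, M j ≠ 0)
    (p q : Fin 4 → ℕ) (hpq : InGeneralPosition fun j => ((p j : ℤ), (q j : ℤ)))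
    {ν : R} {N : K} (hN : N ≠ 0) (hν : ν - algebraMap K R N ∈ maximalIdeal R)
    (h : ∑ j, algebraMap K R (M j) * ((1 + X) ^ p j * (1 + Y) ^ q j) + s * ν = 0) :
    IsSmoothPointOfFiber s ∨ IsOrdinaryDoublePointOfFiber s := by
  have hs : s ∈ maximalIdeal R := by rw [hm]; exact Ideal.subset_span (by simp)
  have hX : X ∈ maximalIdeal R := by rw [hm]; exact Ideal.subset_span (by simp)
  have hY : Y ∈ maximalIdeal R := by rw [hm]; exact Ideal.subset_span (by simp)
  set I := maximalIdeal R with hI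
  have h32 : I ^ 3 ≤ I ^ 2 := Ideal.pow_le_pow_right (by norm_num)
  have h21 : I ^ 2 ≤ I := Ideal.pow_le_self (by norm_num)
  set P := ∑ j, M j * (p j : K) with hP
  set Q := ∑ j, M j * (q j : K) with hQ
  set A := ∑ j, M j * (p j : K) ^ 2 with hA
  set B := ∑ j, M j * ((p j : K) * q j) with hB
  set C := ∑ j, M j * (q j : K) ^ 2 with hC
  set T := ∑ j, M j with hT
  -- The weighted sum of the four expansions, with the sum of the terms replaced by -sν through the
  -- equation.
  have taylor : 4 * (s * ν) + 2 * (2 * algebraMap K R T + 2 * algebraMap K R P * X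
      + 2 * algebraMap K R Q * Y + (algebraMap K R A * X ^ 2 + 2 * algebraMap K R B * (X * Y)
      + algebraMap K R C * Y ^ 2) - algebraMap K R P * X ^ 2 - algebraMap K R Q * Y ^ 2)
      ∈ I ^ 3 := by
    have := Ideal.sum_mem (I ^ 3) (t := Finset.univ) fun j _ => Ideal.mul_mem_left _
      (algebraMap K R (M j)) (one_add_pow_mul_one_add_pow_mem I hX hY (p j) (q j))
    have := neg_mem this
    convert this using 1
    rw [eq_neg_of_add_eq_zero_right h]
    simp only [hP, hQ, hA, hB, hC, hT, map_add, map_mul, map_pow, map_natCast, Fin.sum_univ_four]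
    ring
  have hXX : X ^ 2 ∈ I ^ 2 := Ideal.pow_mem_pow hX 2
  have hYY : Y ^ 2 ∈ I ^ 2 := Ideal.pow_mem_pow hY 2
  have hXY : X * Y ∈ I ^ 2 := by rw [pow_two]; exact Ideal.mul_mem_mul hX hY
  have linear : 4 * (s * ν) + 4 * algebraMap K R T + 4 * algebraMap K R P * X
      + 4 * algebraMap K R Q * Y ∈ I ^ 2 := by
    have := Ideal.sub_mem _ (h32 taylor) (Ideal.add_mem _ (Ideal.add_mem _
      (Ideal.mul_mem_left _ (2 * algebraMap K R A - 2 * algebraMap K R P) hXX)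
      (Ideal.mul_mem_left _ (2 * algebraMap K R C - 2 * algebraMap K R Q) hYY))
      (Ideal.mul_mem_left _ (4 * algebraMap K R B) hXY))
    convert this using 1
    ring
  have hT0 : T = 0 := by
    have := Ideal.sub_mem _ (h21 linear) (Ideal.add_mem _ (Ideal.add_mem _
      (Ideal.mul_mem_left _ (4 * ν) hs) (Ideal.mul_mem_left _ (4 * algebraMap K R P) hX))
      (Ideal.mul_mem_left _ (4 * algebraMap K R Q) hY))
    have h4 : algebraMap K R (4 * T) ∈ I := by
      convert this using 1
      simp only [map_mul, map_ofNat]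
      ring
    simpa using eq_zero_of_algebraMap_mem_maximalIdeal h4
  rw [hT0, map_zero, mul_zero, add_zero] at linear
  rw [hT0, map_zero, mul_zero, zero_add] at taylor
  -- A nonzero first moment is a nonzero partial derivative: the linear part of the equation
  -- expresses X (or Y, below) by the other two generators.
  by_cases hP0 : P ≠ 0
  · left
    refine isSmoothPointOfFiber_of_linear hm (c := 4 * P) (by simpa using hP0) ?_
    have h1 : 4 * ν * s ∈ Ideal.span {s, Y} ⊔ maximalIdeal R ^ 2 := Ideal.mem_sup_left
      (Ideal.mul_mem_left _ _ (Ideal.subset_span (by simp)))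
    have h2 : 4 * algebraMap K R Q * Y ∈ Ideal.span {s, Y} ⊔ maximalIdeal R ^ 2 :=
      Ideal.mem_sup_left (Ideal.mul_mem_left _ _ (Ideal.subset_span (by simp)))
    have := Ideal.sub_mem _ (Ideal.mem_sup_right linear) (Ideal.add_mem _ h1 h2)
    convert this using 1
    simp only [map_mul, map_ofNat]
    ring
  by_cases hQ0 : Q ≠ 0
  · left
    have hm' : maximalIdeal R = Ideal.span {s, Y, X} := hm.trans (by rw [Set.pair_comm X Y])
    refine isSmoothPointOfFiber_of_linear hm' (c := 4 * Q) (by simpa using hQ0) ?_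
    have h1 : 4 * ν * s ∈ Ideal.span {s, X} ⊔ maximalIdeal R ^ 2 := Ideal.mem_sup_left
      (Ideal.mul_mem_left _ _ (Ideal.subset_span (by simp)))
    have h2 : 4 * algebraMap K R P * X ∈ Ideal.span {s, X} ⊔ maximalIdeal R ^ 2 :=
      Ideal.mem_sup_left (Ideal.mul_mem_left _ _ (Ideal.subset_span (by simp)))
    have := Ideal.sub_mem _ (Ideal.mem_sup_right linear) (Ideal.add_mem _ h1 h2)
    convert this using 1
    simp only [map_mul, map_ofNat]
    ring
  right
  push Not at hP0 hQ0
  rw [hP0, hQ0] at taylor linear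
  simp only [map_zero, mul_zero, zero_mul, add_zero, sub_zero, zero_add] at taylor linear
  -- Critical point: there is no linear term left, and ν is a unit because its value N is nonzero.
  have hs2 : s ∈ I ^ 2 := by
    have h4 : algebraMap K R 4 * (s * ν) ∈ I ^ 2 := by simpa only [map_ofNat] using linear
    have := mem_ideal_of_algebraMap_mul_mem (by norm_num) h4
    obtain ⟨w, rfl⟩ := isUnit_of_sub_mem_maximalIdeal hN hν
    have := Ideal.mul_mem_right (↑w⁻¹) _ this
    simpa [mul_assoc] using this
  have hdisc : A * C - B ^ 2 ≠ 0 := by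
    refine moment_discriminant_ne_zero M (fun j => (p j : K)) (fun j => (q j : K)) hM hT0 hP0 hQ0 ?_
    have := hpq 0 1 2 (by decide) (by decide) (by decide)
    simp only [latticeCross] at this
    exact_mod_cast (Int.cast_ne_zero (α := K)).2 this
  have hquad : algebraMap K R (2 * N) * s
      + (algebraMap K R A * X ^ 2 + algebraMap K R (2 * B) * (X * Y)
      + algebraMap K R C * Y ^ 2) ∈ I ^ 3 := by
    have h1 : s * (ν - algebraMap K R N) ∈ I ^ 3 := by
      rw [pow_succ]; exact Ideal.mul_mem_mul hs2 hν
    apply mem_ideal_of_algebraMap_mul_mem (c := (2 : K)) (by norm_num)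
    have := Ideal.sub_mem _ taylor (Ideal.mul_mem_left _ 4 h1)
    convert this using 1
    simp only [map_mul, map_ofNat]
    ring
  obtain ⟨a, b, c, d, hdet, rA, rB, rC⟩ := exists_factor_quadratic A B C hdisc
  rw [rA, rB, rC] at hquad
  have h2N : (2 * N : K) ≠ 0 := mul_ne_zero two_ne_zero hN
  -- The factor -1/(2N) is absorbed into the first linear form, so that s is congruent to u * w
  -- modulo cubes. Cramer's rule then recovers X and Y from u and w.
  set u : R := algebraMap K R (-(2 * N)⁻¹ * a) * X + algebraMap K R (-(2 * N)⁻¹ * b) * Y with hu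
  set w : R := algebraMap K R c * X + algebraMap K R d * Y with hw
  refine ⟨u, w, maximalIdeal_eq_span_pair hm ?_ ?_ ?_ ?_ ?_, ?_⟩
  · exact Ideal.add_mem _ (Ideal.mul_mem_left _ _ hX) (Ideal.mul_mem_left _ _ hY)
  · exact Ideal.add_mem _ (Ideal.mul_mem_left _ _ hX) (Ideal.mul_mem_left _ _ hY)
  · exact Ideal.mem_sup_right hs2
  · apply Ideal.mem_sup_left
    apply mem_ideal_of_algebraMap_mul_mem hdet
    refine Ideal.mem_span_pair.2 ⟨algebraMap K R (-(2 * N) * d), algebraMap K R (-b), ?_⟩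
    have e1 : a * d - b * c = -(2 * N) * d * (-(2 * N)⁻¹ * a) + -b * c := by
      field_simp; ring
    have e2 : (0 : K) = -(2 * N) * d * (-(2 * N)⁻¹ * b) + -b * d := by
      field_simp; ring
    have e2' := congrArg (algebraMap K R) e2
    rw [e1]
    simp only [hu, hw, map_add, map_mul, map_zero] at e2' ⊢
    linear_combination -Y * e2'
  · apply Ideal.mem_sup_left
    apply mem_ideal_of_algebraMap_mul_mem hdet
    refine Ideal.mem_span_pair.2 ⟨algebraMap K R (2 * N * c), algebraMap K R a, ?_⟩
    have e1 : a * d - b * c = 2 * N * c * (-(2 * N)⁻¹ * b) + a * d := by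
      field_simp; ring
    have e2 : (0 : K) = 2 * N * c * (-(2 * N)⁻¹ * a) + a * c := by
      field_simp; ring
    have e2' := congrArg (algebraMap K R) e2
    rw [e1]
    simp only [hu, hw, map_add, map_mul, map_zero] at e2' ⊢
    linear_combination -X * e2'
  · apply mem_ideal_of_algebraMap_mul_mem h2N
    convert hquad using 1
    have e1 : algebraMap K R (2 * N) * algebraMap K R (-(2 * N)⁻¹) = -1 := by
      rw [← map_mul, mul_neg, mul_inv_cancel₀ h2N, map_neg, map_one]
    simp only [hu, hw, map_add, map_mul, map_neg] at e1 ⊢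
    linear_combination -(algebraMap K R a * X + algebraMap K R b * Y) *
      (algebraMap K R c * X + algebraMap K R d * Y) * e1

/-- At a point of a boundary curve `ξ = 0` outside the other one the fiber is smooth. -/
theorem isSmoothPointOfFiber_of_boundary [CharZero K] {s ξ η : R} {η₀ : K} (hη₀ : η₀ ≠ 0)
    (hm : maximalIdeal R = Ideal.span {s, ξ, η - algebraMap K R η₀})
    (κ : Fin 4 → K) (hκ : ∀ j, κ j ≠ 0) (c : Fin 4 → R)
    (hc : ∀ j, c j - algebraMap K R (κ j) ∈ Ideal.span {s})
    (p q : Fin 4 → ℕ) (hpq : InGeneralPosition fun j => ((p j : ℤ), (q j : ℤ)))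
    {i : Fin 4} (hp : p i = 0) (hq : q i = 0)
    (h : ∑ j, c j * (ξ ^ p j * η ^ q j) = 0) :
    IsSmoothPointOfFiber s := by
  have hJ : Ideal.span {s, ξ} ≤ maximalIdeal R := by
    rw [hm]
    exact Ideal.span_mono (by intro z; simp; tauto)
  set J := Ideal.span {s, ξ} with hJdef
  have hηm : η - algebraMap K R η₀ ∈ maximalIdeal R := by
    rw [hm]; exact Ideal.subset_span (by simp)
  have hcJ : ∀ j, c j - algebraMap K R (κ j) ∈ J := fun j =>
    Ideal.span_mono (by simp) (hc j)
  have hξJ : ξ ∈ J := Ideal.subset_span (by simp)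
  have hterm0 : ∀ j, p j ≠ 0 → c j * (ξ ^ p j * η ^ q j) ∈ J := fun j hj =>
    Ideal.mul_mem_left _ _ (Ideal.mul_mem_right _ _ (Ideal.pow_mem_of_mem _ hξJ _
      (Nat.pos_of_ne_zero hj)))
  have hi : c i * (ξ ^ p i * η ^ q i) = c i := by simp [hp, hq]
  -- On ξ = 0 only monomials with p = 0 survive: the constant one and, by general position, at most
  -- one other.
  by_cases hex : ∃ j, j ≠ i ∧ p j = 0
  · obtain ⟨j, hji, hj⟩ := hex
    have hother : ∀ k, k ≠ i → k ≠ j → p k ≠ 0 := by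
      intro k hki hkj hk
      apply hpq k j i hkj hki hji
      simp [latticeCross, hk, hj, hp]
    have hqj : q j ≠ 0 := by
      intro hqj
      obtain ⟨k, hki, hkj⟩ := exists_fin_four_ne i j
      apply hpq k j i hkj hki hji
      simp [latticeCross, hqj, hj, hp, hq]
    have hsum : c i + c j * η ^ q j ∈ J := by
      have h1 : ∑ k ∈ (Finset.univ.erase i).erase j, c k * (ξ ^ p k * η ^ q k) ∈ J :=
        Ideal.sum_mem _ fun k hk => by
          simp only [Finset.mem_erase, Finset.mem_univ, and_true] at hk
          exact hterm0 k (hother k hk.2 hk.1)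
      rw [← Finset.add_sum_erase _ _ (Finset.mem_univ i),
        ← Finset.add_sum_erase _ _ (Finset.mem_erase.2 ⟨hji, Finset.mem_univ j⟩), hi, hj, pow_zero,
        one_mul, ← add_assoc] at h
      rw [eq_neg_of_add_eq_zero_left h]
      exact neg_mem h1
    have hsum2 : algebraMap K R (κ i) + algebraMap K R (κ j) * η ^ q j ∈ J := by
      have := Ideal.sub_mem _ hsum (Ideal.add_mem _ (hcJ i) (Ideal.mul_mem_right (η ^ q j) _ (hcJ j)))
      convert this using 1
      ring
    obtain ⟨w, hw⟩ := exists_add_pow_linear (algebraMap K R η₀) (η - algebraMap K R η₀) (q j)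
    rw [add_sub_cancel] at hw
    have hw' : η ^ q j - algebraMap K R (η₀ ^ q j) = (η - algebraMap K R η₀) *
        (algebraMap K R (q j * η₀ ^ (q j - 1)) + (η - algebraMap K R η₀) * w) := by
      rw [hw]; simp only [map_mul, map_pow, map_natCast]; ring
    have hpt : κ i + κ j * η₀ ^ q j = 0 := by
      apply eq_zero_of_algebraMap_mem_maximalIdeal (R := R)
      have := Ideal.sub_mem _ (hJ hsum2) (Ideal.mul_mem_left _ (algebraMap K R (κ j))
        (hw' ▸ Ideal.mul_mem_right _ _ hηm))
      convert this using 1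
      simp only [map_add, map_mul]; ring
    -- In characteristic zero the derivative of the binomial at η₀ is nonzero, so the root is simple
    -- and η - η₀ lies in the ideal (s, ξ).
    have hU : IsUnit (algebraMap K R (q j * η₀ ^ (q j - 1)) + (η - algebraMap K R η₀) * w) := by
      refine isUnit_of_sub_mem_maximalIdeal (c := q j * η₀ ^ (q j - 1))
        (mul_ne_zero (by exact_mod_cast hqj) (pow_ne_zero _ hη₀)) ?_
      rw [add_sub_cancel_left]
      exact Ideal.mul_mem_right _ _ hηm
    have hmem : (η - algebraMap K R η₀) *
        (algebraMap K R (q j * η₀ ^ (q j - 1)) + (η - algebraMap K R η₀) * w) ∈ J := by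
      rw [← hw']
      apply mem_ideal_of_algebraMap_mul_mem (hκ j)
      convert hsum2 using 1
      have e := congrArg (algebraMap K R) hpt
      simp only [map_add, map_mul, map_zero] at e
      linear_combination -e
    obtain ⟨U, hU⟩ := hU
    rw [← hU] at hmem
    have hηJ : η - algebraMap K R η₀ ∈ J := by
      have := Ideal.mul_mem_right (↑U⁻¹) _ hmem
      simpa [mul_assoc] using this
    refine ⟨ξ, le_antisymm ?_ hJ⟩
    rw [hm, Ideal.span_le]
    rintro z (rfl | rfl | rfl)
    · exact Ideal.subset_span (by simp)
    · exact hξJ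
    · exact hηJ
  -- Only the nonzero constant term survives, so the surface does not meet this boundary curve over
  -- t₀.
  · exfalso
    push Not at hex
    have hsum : c i ∈ J := by
      have h1 : ∑ k ∈ Finset.univ.erase i, c k * (ξ ^ p k * η ^ q k) ∈ J :=
        Ideal.sum_mem _ fun k hk => hterm0 k (hex k (Finset.ne_of_mem_erase hk))
      rw [← Finset.add_sum_erase _ _ (Finset.mem_univ i), hi] at h
      rw [eq_neg_of_add_eq_zero_left h]
      exact neg_mem h1
    refine hκ i (eq_zero_of_algebraMap_mem_maximalIdeal (R := R) (hJ ?_))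
    simpa using Ideal.sub_mem _ hsum (hcJ i)

theorem InGeneralPosition.swap {p q : Fin 4 → ℤ} (h : InGeneralPosition fun j => (p j, q j)) :
    InGeneralPosition fun j => (q j, p j) := by
  intro i j k hij hik hjk h0
  apply h i j k hij hik hjk
  simp only [latticeCross] at h0 ⊢
  linear_combination -h0

/-- The fiber of a family `∑ cⱼ ξ ^ pⱼ η ^ qⱼ = 0` with exponents in general position, one of
which is zero, is smooth or has an ordinary double point. -/
theorem isSmooth_or_isOrdinaryDoublePoint [IsAlgClosed K] [CharZero K] {s ξ η : R} {ξ₀ η₀ : K}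
    (hm : maximalIdeal R = Ideal.span {s, ξ - algebraMap K R ξ₀, η - algebraMap K R η₀})
    (κ : Fin 4 → K) (hκ : ∀ j, κ j ≠ 0)
    (p q : Fin 4 → ℕ) (hpq : InGeneralPosition fun j => ((p j : ℤ), (q j : ℤ)))
    {i : Fin 4} (hp : p i = 0) (hq : q i = 0)
    (h : ∑ j, (algebraMap K R (κ j) + if j = 3 then s else 0) * (ξ ^ p j * η ^ q j) = 0) :
    IsSmoothPointOfFiber s ∨ IsOrdinaryDoublePointOfFiber s := by
  have hc : ∀ j : Fin 4, (algebraMap K R (κ j) + if j = 3 then s else 0) - algebraMap K R (κ j)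
      ∈ Ideal.span {s} := by
    intro j
    rw [add_sub_cancel_left]
    split_ifs
    · exact Ideal.mem_span_singleton_self s
    · exact zero_mem _
  have hs : s ∈ maximalIdeal R := by rw [hm]; exact Ideal.subset_span (by simp)
  have hξm : ξ - algebraMap K R ξ₀ ∈ maximalIdeal R := by
    rw [hm]; exact Ideal.subset_span (by simp)
  have hηm : η - algebraMap K R η₀ ∈ maximalIdeal R := by
    rw [hm]; exact Ideal.subset_span (by simp)
  by_cases hξ₀ : ξ₀ = 0
  · subst hξ₀
    rw [map_zero, sub_zero] at hm hξm
    -- At the corner every nonconstant monomial vanishes, which would force the constant coefficient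
    -- to vanish too.
    by_cases hη₀ : η₀ = 0
    · exfalso
      subst hη₀
      rw [map_zero, sub_zero] at hm hηm
      have hterm : ∀ k ∈ Finset.univ.erase i,
          (algebraMap K R (κ k) + if k = 3 then s else 0) * (ξ ^ p k * η ^ q k)
            ∈ maximalIdeal R := by
        intro k hk
        have hki : k ≠ i := Finset.ne_of_mem_erase hk
        apply Ideal.mul_mem_left
        by_cases hpk : p k = 0
        · have hqk : q k ≠ 0 := by
            intro hqk
            obtain ⟨j, hji, hjk⟩ := exists_fin_four_ne i k
            apply hpq j k i hjk hji hki
            simp [latticeCross, hqk, hpk, hp, hq]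
          exact Ideal.mul_mem_left _ _ (Ideal.pow_mem_of_mem _ hηm _ (Nat.pos_of_ne_zero hqk))
        · exact Ideal.mul_mem_right _ _ (Ideal.pow_mem_of_mem _ hξm _ (Nat.pos_of_ne_zero hpk))
      have h1 := Ideal.sum_mem _ hterm
      rw [← Finset.add_sum_erase _ _ (Finset.mem_univ i), hp, hq, pow_zero, pow_zero, mul_one,
        mul_one] at h
      have h2 := neg_mem h1
      rw [← eq_neg_of_add_eq_zero_left h] at h2
      refine hκ i (eq_zero_of_algebraMap_mem_maximalIdeal (R := R) ?_)
      have h3 := (Ideal.span_singleton_le_iff_mem _).2 hs (hc i)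
      simpa using Ideal.sub_mem _ h2 h3
    · exact .inl (isSmoothPointOfFiber_of_boundary hη₀ hm κ hκ _ hc p q hpq hp hq h)
  by_cases hη₀ : η₀ = 0
  · subst hη₀
    rw [map_zero, sub_zero, Set.pair_comm] at hm
    refine .inl (isSmoothPointOfFiber_of_boundary hξ₀ hm κ hκ _ hc q p hpq.swap hq hp ?_)
    simpa only [mul_comm (η ^ _)] using h
  have hξ : ξ = algebraMap K R ξ₀ * (1 + (algebraMap K R ξ₀⁻¹ * (ξ - algebraMap K R ξ₀))) := by
    rw [mul_add, ← mul_assoc, ← map_mul, mul_inv_cancel₀ hξ₀]; simp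
  have hη : η = algebraMap K R η₀ * (1 + (algebraMap K R η₀⁻¹ * (η - algebraMap K R η₀))) := by
    rw [mul_add, ← mul_assoc, ← map_mul, mul_inv_cancel₀ hη₀]; simp
  set X := algebraMap K R ξ₀⁻¹ * (ξ - algebraMap K R ξ₀) with hX
  set Y := algebraMap K R η₀⁻¹ * (η - algebraMap K R η₀) with hY
  have hm' : maximalIdeal R = Ideal.span {s, X, Y} := by
    apply le_antisymm
    · rw [hm, Ideal.span_le]
      rintro z (rfl | rfl | rfl)
      · exact Ideal.subset_span (by simp)
      · exact mem_ideal_of_algebraMap_mul_mem (inv_ne_zero hξ₀)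
          (Ideal.subset_span (Or.inr (Or.inl rfl)))
      · exact mem_ideal_of_algebraMap_mul_mem (inv_ne_zero hη₀)
          (Ideal.subset_span (Or.inr (Or.inr rfl)))
    · rw [Ideal.span_le]
      rintro z (rfl | rfl | rfl)
      · exact hs
      · exact Ideal.mul_mem_left _ _ hξm
      · exact Ideal.mul_mem_left _ _ hηm
  have hXm : X ∈ maximalIdeal R := Ideal.mul_mem_left _ _ hξm
  have hYm : Y ∈ maximalIdeal R := Ideal.mul_mem_left _ _ hηm
  -- With ξ = ξ₀(1 + X) and η = η₀(1 + Y), the masses are the values of the terms at the point; ν is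
  -- the monomial whose coefficient contains s.
  refine isSmooth_or_isOrdinaryDoublePoint_of_torus hm' (fun j => κ j * (ξ₀ ^ p j * η₀ ^ q j))
    (fun j => mul_ne_zero (hκ j) (mul_ne_zero (pow_ne_zero _ hξ₀) (pow_ne_zero _ hη₀))) p q hpq
    (ν := ξ ^ p 3 * η ^ q 3) (N := ξ₀ ^ p 3 * η₀ ^ q 3)
    (mul_ne_zero (pow_ne_zero _ hξ₀) (pow_ne_zero _ hη₀)) ?_ ?_
  · rw [map_mul, map_pow, map_pow]
    rw [← Ideal.Quotient.eq_zero_iff_mem] at hξm hηm ⊢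
    simp only [map_sub, map_mul, map_pow] at hξm hηm ⊢
    rw [sub_eq_zero.1 hξm, sub_eq_zero.1 hηm, sub_self]
  · rw [← h]
    rw [hξ, hη]
    simp only [Fin.sum_univ_four, map_mul, map_pow, mul_pow]
    simp
    ring

end LocalAlgebra

/-! ### Toric blow-ups of monomial charts -/

section Refinement

variable {K : Type u} {L : Type v} [Field K] [Field L] [Algebra K L]

theorem self_mem_localRingAtCenter {A : Subalgebra K L} {O : ValuationSubring L} {z : L}
    (hz : z ∈ A) : z ∈ localRingAtCenter A O :=
  ⟨z, hz, 1, one_mem _, map_one _, by simp⟩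

/-- The local ring at the center of a valuation ring, as a subalgebra. -/
def localSubalgebra (A : Subalgebra K L) (O : ValuationSubring L) : Subalgebra K L where
  carrier := localRingAtCenter A O
  mul_mem' := by
    rintro _ _ ⟨a, ha, b, hb, vb, rfl⟩ ⟨c, hc, d, hd, vd, rfl⟩
    exact ⟨a * c, mul_mem ha hc, b * d, mul_mem hb hd, by simp [vb, vd],
      div_mul_div_comm a b c d⟩
  add_mem' := by
    rintro _ _ ⟨a, ha, b, hb, vb, rfl⟩ ⟨c, hc, d, hd, vd, rfl⟩
    have hb0 : b ≠ 0 := by rintro rfl; simp at vb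
    have hd0 : d ≠ 0 := by rintro rfl; simp at vd
    exact ⟨a * d + b * c, add_mem (mul_mem ha hd) (mul_mem hb hc), b * d, mul_mem hb hd,
      by simp [vb, vd], div_add_div a c hb0 hd0⟩
  algebraMap_mem' c := self_mem_localRingAtCenter (A.algebraMap_mem c)

theorem inv_mem_localSubalgebra {A : Subalgebra K L} {O : ValuationSubring L} {z : L}
    (hz : z ∈ localSubalgebra A O) (hv : O.valuation z = 1) : z⁻¹ ∈ localSubalgebra A O := by
  obtain ⟨a, ha, b, hb, vb, rfl⟩ := hz
  refine ⟨b, hb, a, ha, ?_, inv_div a b⟩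
  simpa [vb] using hv

theorem ValuationSubring.valuation_eq_one_of_mem_of_inv_mem {O : ValuationSubring L} {z : L}
    (h0 : z ≠ 0) (hz : z ∈ O) (hz' : z⁻¹ ∈ O) : O.valuation z = 1 := by
  apply le_antisymm ((O.valuation_le_one_iff z).2 hz)
  have := (O.valuation_le_one_iff _).2 hz'
  rw [map_inv₀] at this
  exact (inv_le_one₀ (zero_lt_iff.2 (by simpa using h0))).1 this

/-- Elements of B of valuation one are already units in the local ring of A. -/
theorem localSubalgebra_mono {A B : Subalgebra K L} {O : ValuationSubring L}
    (h : B ≤ localSubalgebra A O) : localSubalgebra B O ≤ localSubalgebra A O := by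
  rintro _ ⟨a, ha, b, hb, vb, rfl⟩
  rw [div_eq_mul_inv]
  exact mul_mem (h ha) (inv_mem_localSubalgebra (h hb) vb)

variable (K) in
/-- The affine chart with coordinates `q.1, q.2` over `Spec K[t, t⁻¹]`. -/
def coordinateChart (t : L) (q : L × L) : Subalgebra K L := Algebra.adjoin K {t, t⁻¹, q.1, q.2}

section Chart

variable {t : L} {q : L × L}

theorem fst_mem_coordinateChart : q.1 ∈ coordinateChart K t q := Algebra.subset_adjoin (by simp)

theorem snd_mem_coordinateChart : q.2 ∈ coordinateChart K t q := Algebra.subset_adjoin (by simp)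

theorem adjoin_le_coordinateChart : Algebra.adjoin K {t, t⁻¹} ≤ coordinateChart K t q :=
  Algebra.adjoin_mono (by intro z; simp; tauto)

theorem coordinateChart_le {A : Subalgebra K L} (ht : Algebra.adjoin K {t, t⁻¹} ≤ A)
    (h1 : q.1 ∈ A) (h2 : q.2 ∈ A) : coordinateChart K t q ≤ A := by
  refine Algebra.adjoin_le ?_
  rintro z (rfl | rfl | rfl | rfl)
  · exact ht (Algebra.subset_adjoin (by simp))
  · exact ht (Algebra.subset_adjoin (by simp))
  · exact h1
  · exact h2

theorem forall_mem_coordinateChart {O : ValuationSubring L}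
    (hO : ∀ z ∈ Algebra.adjoin K {t, t⁻¹}, z ∈ O) (h1 : q.1 ∈ O) (h2 : q.2 ∈ O) :
    ∀ z ∈ coordinateChart K t q, z ∈ O := by
  let O' : Subalgebra K L := { O.toSubring with
    algebraMap_mem' := fun c => hO _ (Subalgebra.algebraMap_mem _ c) }
  exact coordinateChart_le (A := O') hO h1 h2

theorem coordinateChart_le_localSubalgebra {q' : L × L} {O : ValuationSubring L}
    (h1 : q.1 ∈ localSubalgebra (coordinateChart K t q') O)
    (h2 : q.2 ∈ localSubalgebra (coordinateChart K t q') O) :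
    coordinateChart K t q ≤ localSubalgebra (coordinateChart K t q') O :=
  coordinateChart_le (fun _ hz => self_mem_localRingAtCenter (adjoin_le_coordinateChart hz)) h1 h2

/-- Charts are glued with this criterion: only the coordinates have to be compared, since they
generate the charts over the common base. -/
theorem localRingAtCenter_coordinateChart_eq {q' : L × L} {O : ValuationSubring L}
    (h1 : q.1 ∈ localSubalgebra (coordinateChart K t q') O)
    (h2 : q.2 ∈ localSubalgebra (coordinateChart K t q') O)
    (h1' : q'.1 ∈ localSubalgebra (coordinateChart K t q) O)
    (h2' : q'.2 ∈ localSubalgebra (coordinateChart K t q) O) :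
    localRingAtCenter (coordinateChart K t q) O = localRingAtCenter (coordinateChart K t q') O :=
  congrArg (fun A : Subalgebra K L => (A : Set L))
    (le_antisymm (localSubalgebra_mono (coordinateChart_le_localSubalgebra h1 h2))
      (localSubalgebra_mono (coordinateChart_le_localSubalgebra h1' h2')))

theorem fst_mem_localSubalgebra {O : ValuationSubring L} :
    q.1 ∈ localSubalgebra (coordinateChart K t q) O :=
  self_mem_localRingAtCenter fst_mem_coordinateChart

theorem snd_mem_localSubalgebra {O : ValuationSubring L} :
    q.2 ∈ localSubalgebra (coordinateChart K t q) O :=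
  self_mem_localRingAtCenter snd_mem_coordinateChart

end Chart

variable (K) in
/-- The charts with coordinates in the list `l` are obtained from the chart with coordinates `q`
by blowing up intersections of coordinate axes. -/
structure IsRefinement (t : L) (q : L × L) (l : List (L × L)) : Prop where
  le : ∀ r ∈ l, coordinateChart K t q ≤ coordinateChart K t r
  exists_center : ∀ O : ValuationSubring L, q.1 ∈ O → q.2 ∈ O → ∃ r ∈ l, r.1 ∈ O ∧ r.2 ∈ O
  -- Nothing changes away from the corner where both coordinates vanish. This is what allows
  -- different charts to be refined independently and still glued.
  localRing_eq : ∀ O : ValuationSubring L, ∀ r ∈ l, (∀ z ∈ coordinateChart K t r, z ∈ O) →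
    (q.1⁻¹ ∈ O ∨ q.2⁻¹ ∈ O) →
      localRingAtCenter (coordinateChart K t r) O = localRingAtCenter (coordinateChart K t q) O
  center_unique : ∀ O : ValuationSubring L, ∀ r ∈ l, ∀ r' ∈ l,
    (∀ z ∈ coordinateChart K t r, z ∈ O) → (∀ z ∈ coordinateChart K t r', z ∈ O) →
      localRingAtCenter (coordinateChart K t r) O = localRingAtCenter (coordinateChart K t r') O

namespace IsRefinement

variable {t : L}

theorem refl (q : L × L) : IsRefinement K t q [q] where
  le := by simp
  exists_center O h1 h2 := ⟨q, by simp, h1, h2⟩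
  localRing_eq := by
    intro O r hr _ _
    rw [List.mem_singleton.1 hr]
  center_unique := by
    intro O r hr r' hr' _ _
    rw [List.mem_singleton.1 hr, List.mem_singleton.1 hr']

theorem fst_mem {q r : L × L} {l : List (L × L)} (h : IsRefinement K t q l) (hr : r ∈ l)
    {O : ValuationSubring L} (hO : ∀ z ∈ coordinateChart K t r, z ∈ O) : q.1 ∈ O :=
  hO _ (h.le r hr fst_mem_coordinateChart)

theorem snd_mem {q r : L × L} {l : List (L × L)} (h : IsRefinement K t q l) (hr : r ∈ l)
    {O : ValuationSubring L} (hO : ∀ z ∈ coordinateChart K t r, z ∈ O) : q.2 ∈ O :=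
  hO _ (h.le r hr snd_mem_coordinateChart)

/-- Where ξ is a unit, dividing η by it does not change the local ring: the blow-up is an
isomorphism there. -/
theorem localRing_eq_of_inv_mem {ξ η : L} (hξ : ξ ≠ 0) {O : ValuationSubring L} (h : ξ ∈ O)
    (h' : ξ⁻¹ ∈ O) :
    localRingAtCenter (coordinateChart K t (ξ, η / ξ)) O
      = localRingAtCenter (coordinateChart K t (ξ, η)) O := by
  have v := ValuationSubring.valuation_eq_one_of_mem_of_inv_mem hξ h h'
  refine localRingAtCenter_coordinateChart_eq fst_mem_localSubalgebra ?_
    fst_mem_localSubalgebra ?_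
  · show η / ξ ∈ _
    rw [div_eq_mul_inv]
    exact mul_mem snd_mem_localSubalgebra (inv_mem_localSubalgebra fst_mem_localSubalgebra v)
  · show η ∈ _
    have := mul_mem (fst_mem_localSubalgebra (K := K) (t := t) (q := (ξ, η / ξ)) (O := O))
      snd_mem_localSubalgebra
    simpa [mul_div_cancel₀ _ hξ] using this

theorem coordinateChart_swap (ξ η : L) :
    coordinateChart K t (ξ, η) = coordinateChart K t (η, ξ) := by
  rw [coordinateChart, coordinateChart, Set.pair_comm ξ η]

/-- Refinements of the two charts of a blow-up form a refinement of the original chart. -/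
theorem blowUp {ξ η : L} (hξ : ξ ≠ 0) (hη : η ≠ 0) {l₁ l₂ : List (L × L)}
    (h₁ : IsRefinement K t (ξ, η / ξ) l₁) (h₂ : IsRefinement K t (ξ / η, η) l₂) :
    IsRefinement K t (ξ, η) (l₁ ++ l₂) := by
  -- On the overlap η / ξ is a unit, so the center avoids the corners of both blow-up charts and the
  -- refinements are invisible.
  have mixed : ∀ O : ValuationSubring L, ∀ r ∈ l₁, ∀ r' ∈ l₂,
      (∀ z ∈ coordinateChart K t r, z ∈ O) → (∀ z ∈ coordinateChart K t r', z ∈ O) →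
      localRingAtCenter (coordinateChart K t r) O
        = localRingAtCenter (coordinateChart K t r') O := by
    intro O r hr r' hr' hO hO'
    have m1 : η / ξ ∈ O := h₁.snd_mem hr hO
    have m2 : ξ / η ∈ O := h₂.fst_mem hr' hO'
    have v1 := ValuationSubring.valuation_eq_one_of_mem_of_inv_mem (div_ne_zero hη hξ) m1
      (by rwa [inv_div])
    have v2 := ValuationSubring.valuation_eq_one_of_mem_of_inv_mem (div_ne_zero hξ hη) m2
      (by rwa [inv_div])
    rw [h₁.localRing_eq O r hr hO (Or.inr (by simpa using m2)),
      h₂.localRing_eq O r' hr' hO' (Or.inl (by simpa using m1))]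
    refine localRingAtCenter_coordinateChart_eq ?_ ?_ ?_ ?_
    · have := mul_mem (fst_mem_localSubalgebra (K := K) (t := t) (q := (ξ / η, η)) (O := O))
        snd_mem_localSubalgebra
      simpa [div_mul_cancel₀ _ hη] using this
    · simpa using inv_mem_localSubalgebra (K := K)
        (fst_mem_localSubalgebra (K := K) (t := t) (q := (ξ / η, η)) (O := O)) v2
    · simpa using inv_mem_localSubalgebra (K := K)
        (snd_mem_localSubalgebra (K := K) (t := t) (q := (ξ, η / ξ)) (O := O)) v1
    · have := mul_mem (fst_mem_localSubalgebra (K := K) (t := t) (q := (ξ, η / ξ)) (O := O))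
        snd_mem_localSubalgebra
      simpa [mul_div_cancel₀ _ hξ] using this
  have le₁ : coordinateChart K t (ξ, η) ≤ coordinateChart K t (ξ, η / ξ) := by
    refine coordinateChart_le adjoin_le_coordinateChart fst_mem_coordinateChart ?_
    have := mul_mem (fst_mem_coordinateChart (K := K) (t := t) (q := (ξ, η / ξ)))
      snd_mem_coordinateChart
    simpa [mul_div_cancel₀ _ hξ] using this
  have le₂ : coordinateChart K t (ξ, η) ≤ coordinateChart K t (ξ / η, η) := by
    refine coordinateChart_le adjoin_le_coordinateChart ?_ snd_mem_coordinateChart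
    have := mul_mem (fst_mem_coordinateChart (K := K) (t := t) (q := (ξ / η, η)))
      snd_mem_coordinateChart
    simpa [div_mul_cancel₀ _ hη] using this
  refine ⟨?_, ?_, ?_, ?_⟩
  · intro r hr
    rcases List.mem_append.1 hr with hr | hr
    · exact le₁.trans (h₁.le r hr)
    · exact le₂.trans (h₂.le r hr)
  · intro O m1 m2
    -- A valuation ring contains η / ξ or its inverse, which selects the chart of the blow-up.
    rcases O.mem_or_inv_mem (η / ξ) with h | h
    · obtain ⟨r, hr, hrO⟩ := h₁.exists_center O m1 h
      exact ⟨r, List.mem_append_left _ hr, hrO⟩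
    · rw [inv_div] at h
      obtain ⟨r, hr, hrO⟩ := h₂.exists_center O h m2
      exact ⟨r, List.mem_append_right _ hr, hrO⟩
  · intro O r hr hO hinv
    rcases List.mem_append.1 hr with hr | hr
    · have m1 : ξ ∈ O := h₁.fst_mem hr hO
      have m2 : η / ξ ∈ O := h₁.snd_mem hr hO
      have hξ' : ξ⁻¹ ∈ O := by
        rcases hinv with h | h
        · exact h
        · convert O.mul_mem _ _ m2 h using 1
          field_simp
      rw [h₁.localRing_eq O r hr hO (Or.inl hξ'), localRing_eq_of_inv_mem hξ m1 hξ']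
    · have m1 : η ∈ O := h₂.snd_mem hr hO
      have m2 : ξ / η ∈ O := h₂.fst_mem hr hO
      have hη' : η⁻¹ ∈ O := by
        rcases hinv with h | h
        · convert O.mul_mem _ _ m2 h using 1
          field_simp
        · exact h
      rw [h₂.localRing_eq O r hr hO (Or.inr hη'), coordinateChart_swap,
        localRing_eq_of_inv_mem hη m1 hη', coordinateChart_swap]
  · intro O r hr r' hr' hO hO'
    rcases List.mem_append.1 hr with hr | hr <;> rcases List.mem_append.1 hr' with hr' | hr'
    · exact h₁.center_unique O r hr r' hr' hO hO'
    · exact mixed O r hr r' hr' hO hO'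
    · exact (mixed O r' hr' r hr hO' hO).symm
    · exact h₂.center_unique O r hr r' hr' hO hO'

end IsRefinement

/-- The defect of a difference of two exponents: zero unless it has the signs `+-`. -/
def exponentDefect (d : ℤ × ℤ) : ℕ := if 0 < d.1 ∧ d.2 < 0 then d.1.natAbs + d.2.natAbs else 0

/-- The total defect of a family of exponents. -/
def totalDefect (e : Fin 4 → ℤ × ℤ) : ℕ := ∑ i, ∑ j, exponentDefect (e i - e j)

/-- The exponents in the chart `(ξ, η / ξ)` of a blow-up. -/
def blowUpFst (e : Fin 4 → ℤ × ℤ) : Fin 4 → ℤ × ℤ := fun j => ((e j).1 + (e j).2, (e j).2)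

/-- The exponents in the chart `(ξ / η, η)` of a blow-up. -/
def blowUpSnd (e : Fin 4 → ℤ × ℤ) : Fin 4 → ℤ × ℤ := fun j => ((e j).1, (e j).1 + (e j).2)

theorem totalDefect_lt {e e' : Fin 4 → ℤ × ℤ}
    (hle : ∀ i j, exponentDefect (e' i - e' j) ≤ exponentDefect (e i - e j))
    (hlt : ∃ i j, exponentDefect (e' i - e' j) < exponentDefect (e i - e j)) :
    totalDefect e' < totalDefect e := by
  obtain ⟨i, j, hij⟩ := hlt
  refine Finset.sum_lt_sum (fun i _ => Finset.sum_le_sum fun j _ => hle i j)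
    ⟨i, Finset.mem_univ i, Finset.sum_lt_sum (fun j _ => hle i j) ⟨j, Finset.mem_univ j, hij⟩⟩

/-- A difference (d₁, d₂) with d₁ > 0 > d₂ becomes (d₁ + d₂, d₂): its defect d₁ + |d₂| drops to d₁
or to 0. A difference of any other sign pattern keeps defect 0. The other chart is symmetric. -/
theorem totalDefect_blowUpFst_lt {e : Fin 4 → ℤ × ℤ}
    (h : ∃ i j, (e j).1 < (e i).1 ∧ (e i).2 < (e j).2) :
    totalDefect (blowUpFst e) < totalDefect e := by
  obtain ⟨i, j, h1, h2⟩ := h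
  refine totalDefect_lt (fun i j => ?_) ⟨i, j, ?_⟩ <;>
  · simp only [exponentDefect, blowUpFst, Prod.fst_sub, Prod.snd_sub]
    grind

theorem totalDefect_blowUpSnd_lt {e : Fin 4 → ℤ × ℤ}
    (h : ∃ i j, (e j).1 < (e i).1 ∧ (e i).2 < (e j).2) :
    totalDefect (blowUpSnd e) < totalDefect e := by
  obtain ⟨i, j, h1, h2⟩ := h
  refine totalDefect_lt (fun i j => ?_) ⟨i, j, ?_⟩ <;>
  · simp only [exponentDefect, blowUpSnd, Prod.fst_sub, Prod.snd_sub]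
    grind

/-- A chart with monomials in its coordinates has a refinement on every chart of which one of the
monomials divides all others. -/
theorem exists_refinement (t : L) (P : L × L → (Fin 4 → ℤ × ℤ) → Prop)
    (hne : ∀ q e, P q e → q.1 ≠ 0 ∧ q.2 ≠ 0)
    (hfst : ∀ ξ η e, P (ξ, η) e → P (ξ, η / ξ) (blowUpFst e))
    (hsnd : ∀ ξ η e, P (ξ, η) e → P (ξ / η, η) (blowUpSnd e))
    {q : L × L} {e : Fin 4 → ℤ × ℤ} (hP : P q e) :
    ∃ l, IsRefinement K t q l ∧ ∀ r ∈ l, ∃ e', P r e' ∧ ∃ i, ∀ j, e' i ≤ e' j := by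
  induction hn : totalDefect e using Nat.strong_induction_on generalizing q e with
  | _ n ih =>
    subst hn
    by_cases h : ∃ i j, (e j).1 < (e i).1 ∧ (e i).2 < (e j).2
    · obtain ⟨ξ, η⟩ := q
      obtain ⟨l₁, h₁, h₁'⟩ := ih _ (totalDefect_blowUpFst_lt h) (hfst ξ η e hP) rfl
      obtain ⟨l₂, h₂, h₂'⟩ := ih _ (totalDefect_blowUpSnd_lt h) (hsnd ξ η e hP) rfl
      obtain ⟨hξ, hη⟩ := hne _ _ hP
      refine ⟨l₁ ++ l₂, .blowUp hξ hη h₁ h₂, fun r hr => ?_⟩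
      rcases List.mem_append.1 hr with hr | hr
      · exact h₁' r hr
      · exact h₂' r hr
    · refine ⟨[q], .refl q, fun r hr => ⟨e, by rwa [List.mem_singleton.1 hr], ?_⟩⟩
      push Not at h
      -- Without incomparable pairs the exponents form a chain, so one with minimal coordinate sum
      -- is below all others.
      obtain ⟨i, hi⟩ := Finite.exists_min fun i => (e i).1 + (e i).2
      refine ⟨i, fun j => ?_⟩
      have h1 := h i j
      have h2 := h j i
      have h3 := hi j
      rw [Prod.le_def]
      constructor
      · by_contra hc
        push Not at hc
        have := h1 hc
        omega
      · by_contra hc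
        push Not at hc
        rcases lt_or_ge (e i).1 (e j).1 with hh | hh
        · have := h2 hh
          omega
        · omega

end Refinement

/-! ### The semistable model for exponents in general position -/

section SemistableModel

variable {K : Type u} {L : Type v} [Field K] [Field L] [Algebra K L]

/-- Nullstellensatz: the residue field is finite over the algebraically closed field K, hence equal
to it. -/
theorem exists_sub_algebraMap_mem [IsAlgClosed K] {A : Type*} [CommRing A] [Algebra K A]
    [Algebra.FiniteType K A] (I : Ideal A) [hI : I.IsMaximal] (a : A) :
    ∃ c : K, a - algebraMap K A c ∈ I := by
  let := Ideal.Quotient.field I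
  have := finite_of_finite_type_of_isJacobsonRing K (A ⧸ I)
  obtain ⟨c, hc⟩ := (IsAlgClosed.algebraMap_bijective_of_isIntegral (k := K) (K := A ⧸ I)).2
    (Ideal.Quotient.mk I a)
  refine ⟨c, ?_⟩
  rw [← Ideal.Quotient.eq, ← hc]
  rfl

theorem coordinateChart_fg (t : L) (q : L × L) : (coordinateChart K t q).FG :=
  Subalgebra.fg_def.2 ⟨_, Set.toFinite _, rfl⟩

theorem coordinateChart_finiteType (t : L) (q : L × L) :
    Algebra.FiniteType K (coordinateChart K t q) :=
  (Subalgebra.fg_iff_finiteType _).1 (coordinateChart_fg t q)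

/-- A maximal ideal of a chart in the fiber over `t₀` is generated by the three coordinates. -/
theorem exists_eq_span_of_isMaximal [IsAlgClosed K] {t : L} (ht : t ≠ 0) {q : L × L} {t₀ : K}
    (ht₀ : t₀ ≠ 0) (I : Ideal (coordinateChart K t q)) [hI : I.IsMaximal]
    {s ξ η : coordinateChart K t q}
    (hs : (s : L) = t - algebraMap K L t₀) (hsI : s ∈ I) (hξ : (ξ : L) = q.1) (hη : (η : L) = q.2) :
    ∃ ξ₀ η₀ : K, I = Ideal.span {s, ξ - algebraMap K _ ξ₀, η - algebraMap K _ η₀} := by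
  have := coordinateChart_finiteType (K := K) t q
  obtain ⟨ξ₀, hξ₀⟩ := exists_sub_algebraMap_mem (K := K) I ξ
  obtain ⟨η₀, hη₀⟩ := exists_sub_algebraMap_mem (K := K) I η
  refine ⟨ξ₀, η₀, ?_⟩
  set J := Ideal.span {s, ξ - algebraMap K _ ξ₀, η - algebraMap K _ η₀} with hJ
  have hJI : J ≤ I := by
    rw [hJ, Ideal.span_le]
    rintro z (rfl | rfl | rfl) <;> assumption
  have hsJ : s ∈ J := Ideal.subset_span (by simp)
  have hξJ : ξ - algebraMap K _ ξ₀ ∈ J := Ideal.subset_span (by simp)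
  have hηJ : η - algebraMap K _ η₀ ∈ J := Ideal.subset_span (by simp)
  -- Every element is constant modulo J, as may be checked on generators; for the inverse of t this
  -- uses t₀ ≠ 0. So J is as large as the maximal ideal containing it.
  have key : ∀ z (hz : z ∈ coordinateChart K t q),
      ∃ c : K, (⟨z, hz⟩ : coordinateChart K t q) - algebraMap K _ c ∈ J := by
    intro z hz
    induction hz using Algebra.adjoin_induction with
    | mem z hz =>
      have ht' : t⁻¹ ∈ coordinateChart K t q := Algebra.subset_adjoin (by simp)
      rcases hz with rfl | rfl | rfl | rfl
      · exact ⟨t₀, by convert hsJ using 1; exact Subtype.ext hs.symm⟩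
      · refine ⟨t₀⁻¹, ?_⟩
        have := J.mul_mem_left (-(algebraMap K _ t₀⁻¹) * ⟨t⁻¹, ht'⟩) hsJ
        convert this using 1
        apply Subtype.ext
        have h0 : algebraMap K L t₀ ≠ 0 := by simpa using ht₀
        show t⁻¹ - algebraMap K L t₀⁻¹ = -(algebraMap K L t₀⁻¹) * t⁻¹ * s
        rw [hs, map_inv₀]
        field_simp
        ring
      · exact ⟨ξ₀, by convert hξJ using 2; exact Subtype.ext hξ.symm⟩
      · exact ⟨η₀, by convert hηJ using 2; exact Subtype.ext hη.symm⟩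
    | algebraMap c =>
      refine ⟨c, ?_⟩
      convert J.zero_mem using 1
      exact sub_self _
    | add a b ha hb iha ihb =>
      obtain ⟨c, hc⟩ := iha
      obtain ⟨d, hd⟩ := ihb
      refine ⟨c + d, ?_⟩
      convert J.add_mem hc hd using 1
      apply Subtype.ext
      simp
      ring
    | mul a b ha hb iha ihb =>
      obtain ⟨c, hc⟩ := iha
      obtain ⟨d, hd⟩ := ihb
      refine ⟨c * d, ?_⟩
      convert J.add_mem (J.mul_mem_right ⟨b, hb⟩ hc) (J.mul_mem_left (algebraMap K _ c) hd) using 1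
      apply Subtype.ext
      simp
      ring
  refine le_antisymm (fun z hz => ?_) hJI
  obtain ⟨c, hc⟩ := key z.1 z.2
  have hcI : algebraMap K (coordinateChart K t q) c ∈ I := by
    simpa using I.sub_mem hz (hJI hc)
  have hc0 : c = 0 := by
    by_contra h
    exact hI.ne_top (Ideal.eq_top_of_isUnit_mem _ hcI ((IsUnit.mk0 c h).map (algebraMap K _)))
  simpa [hc0] using hc

/-- The fiber over `t₀ ≠ 0` is smooth or semistable on a chart in which the surface is given by
monomials in general position, one of which is constant. -/
theorem isSmooth_or_isOrdinaryDoublePoint_of_coordinateChart [IsAlgClosed K] [CharZero K] {t : L}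
    (ht : t ≠ 0) {q : L × L} (a b : Fin 4 → ℕ)
    (hab : InGeneralPosition fun j => ((a j : ℤ), (b j : ℤ))) {i : Fin 4} (ha : a i = 0)
    (hb : b i = 0) (h : ∑ j, (if j = 3 then t else 1) * (q.1 ^ a j * q.2 ^ b j) = 0)
    {t₀ : K} (ht₀ : t₀ ≠ 0) (I : Ideal (coordinateChart K t q)) [hI : I.IsMaximal]
    {s : coordinateChart K t q} (hs : (s : L) = t - algebraMap K L t₀) (hsI : s ∈ I) :
    IsSmoothPointOfFiber (algebraMap _ (Localization.AtPrime I) s) ∨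
      IsOrdinaryDoublePointOfFiber (algebraMap _ (Localization.AtPrime I) s) := by
  let ξ : coordinateChart K t q := ⟨q.1, fst_mem_coordinateChart⟩
  let η : coordinateChart K t q := ⟨q.2, snd_mem_coordinateChart⟩
  obtain ⟨ξ₀, η₀, hspan⟩ := exists_eq_span_of_isMaximal ht ht₀ I hs hsI
    (show (ξ : L) = q.1 from rfl) (show (η : L) = q.2 from rfl)
  have hm : maximalIdeal (Localization.AtPrime I) = Ideal.span {algebraMap _ _ s,
      algebraMap _ (Localization.AtPrime I) ξ - algebraMap K _ ξ₀,
      algebraMap _ (Localization.AtPrime I) η - algebraMap K _ η₀} := by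
    rw [← Localization.AtPrime.map_eq_maximalIdeal]
    refine (congrArg (Ideal.map (algebraMap _ (Localization.AtPrime I))) hspan).trans ?_
    rw [Ideal.map_span]
    simp only [Set.image_insert_eq, Set.image_singleton, map_sub,
      ← IsScalarTower.algebraMap_apply]
  -- The coefficient t of the last monomial is split as t₀ + s.
  refine isSmooth_or_isOrdinaryDoublePoint hm (fun j => if j = 3 then t₀ else 1) ?_ a b hab ha hb ?_
  · intro j
    split_ifs
    · exact ht₀
    · exact one_ne_zero
  · have hA : ∑ j : Fin 4, (algebraMap K (coordinateChart K t q) (if j = 3 then t₀ else 1)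
        + if j = 3 then s else 0) * (ξ ^ a j * η ^ b j) = 0 := by
      apply Subtype.ext
      simp only [AddSubmonoidClass.coe_finsetSum, MulMemClass.coe_mul, AddMemClass.coe_add,
        SubmonoidClass.coe_pow, ZeroMemClass.coe_zero]
      rw [← h]
      refine Finset.sum_congr rfl fun j _ => ?_
      congr 1
      split_ifs
      · rw [hs, Subalgebra.coe_algebraMap]; ring
      · simp
    have := congrArg (algebraMap _ (Localization.AtPrime I)) hA
    simp only [map_sum, map_mul, map_add, map_pow, map_zero, ← IsScalarTower.algebraMap_apply]
      at this
    refine Eq.trans ?_ this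
    refine Finset.sum_congr rfl fun j _ => ?_
    congr 2
    split_ifs <;> simp

/-- The coordinates `q` of a toric chart, in which the monomials `m j` have the exponents `e j`. -/
structure IsMonomialChart (x y : L) (m : Fin 4 → L) (q : L × L) (e : Fin 4 → ℤ × ℤ) : Prop where
  fst_ne_zero : q.1 ≠ 0
  snd_ne_zero : q.2 ≠ 0
  x_eq : ∃ a b : ℤ, x = q.1 ^ a * q.2 ^ b
  y_eq : ∃ a b : ℤ, y = q.1 ^ a * q.2 ^ b
  monomial_eq : ∀ j, m j = q.1 ^ (e j).1 * q.2 ^ (e j).2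
  inGeneralPosition : InGeneralPosition e

namespace IsMonomialChart

variable {x y t : L} {m : Fin 4 → L}

/-- The exponents change by a unimodular matrix, which preserves areas and hence general position.
-/
theorem blowUpFst {ξ η : L} {e : Fin 4 → ℤ × ℤ} (h : IsMonomialChart x y m (ξ, η) e) :
    IsMonomialChart x y m (ξ, η / ξ) (blowUpFst e) := by
  obtain ⟨hξ, hη, ⟨a, b, hx⟩, ⟨c, d, hy⟩, hm, hg⟩ := h
  have key : ∀ a b : ℤ, ξ ^ a * η ^ b = ξ ^ (a + b) * (η / ξ) ^ b := by
    intro a b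
    rw [zpow_add₀ hξ, div_zpow]
    have := zpow_ne_zero b hξ
    field_simp
  refine ⟨hξ, div_ne_zero hη hξ, ⟨a + b, b, hx.trans (key a b)⟩, ⟨c + d, d, hy.trans (key c d)⟩,
    fun j => (hm j).trans (key _ _), fun i j k hij hik hjk h0 => hg i j k hij hik hjk ?_⟩
  simp only [latticeCross, _root_.blowUpFst] at h0 ⊢
  linear_combination h0

theorem blowUpSnd {ξ η : L} {e : Fin 4 → ℤ × ℤ} (h : IsMonomialChart x y m (ξ, η) e) :
    IsMonomialChart x y m (ξ / η, η) (blowUpSnd e) := by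
  obtain ⟨hξ, hη, ⟨a, b, hx⟩, ⟨c, d, hy⟩, hm, hg⟩ := h
  have key : ∀ a b : ℤ, ξ ^ a * η ^ b = (ξ / η) ^ a * η ^ (a + b) := by
    intro a b
    rw [zpow_add₀ hη, div_zpow]
    have := zpow_ne_zero a hη
    field_simp
  refine ⟨div_ne_zero hξ hη, hη, ⟨a, a + b, hx.trans (key a b)⟩, ⟨c, c + d, hy.trans (key c d)⟩,
    fun j => (hm j).trans (key _ _), fun i j k hij hik hjk h0 => hg i j k hij hik hjk ?_⟩
  simp only [latticeCross, _root_.blowUpSnd] at h0 ⊢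
  linear_combination h0

/-- The change of coordinates between two charts of the projective plane. -/
theorem rotate {ξ η : L} {e : Fin 4 → ℤ × ℤ} (h : IsMonomialChart x y m (ξ, η) e) :
    IsMonomialChart x y m (ξ⁻¹, η * ξ⁻¹) (fun j => (-(e j).1 - (e j).2, (e j).2)) := by
  obtain ⟨hξ, hη, ⟨a, b, hx⟩, ⟨c, d, hy⟩, hm, hg⟩ := h
  have key : ∀ a b : ℤ, ξ ^ a * η ^ b = ξ⁻¹ ^ (-a - b) * (η * ξ⁻¹) ^ b := by
    intro a b
    rw [inv_zpow', mul_zpow, inv_zpow', mul_left_comm, ← zpow_add₀ hξ, mul_comm]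
    congr 2
    ring
  refine ⟨inv_ne_zero hξ, mul_ne_zero hη (inv_ne_zero hξ), ⟨_, _, hx.trans (key a b)⟩,
    ⟨_, _, hy.trans (key c d)⟩, fun j => (hm j).trans (key _ _),
    fun i j k hij hik hjk h0 => hg i j k hij hik hjk ?_⟩
  simp only [latticeCross] at h0 ⊢
  linear_combination -h0

theorem swap {ξ η : L} {e : Fin 4 → ℤ × ℤ} (h : IsMonomialChart x y m (ξ, η) e) :
    IsMonomialChart x y m (η, ξ) (fun j => ((e j).2, (e j).1)) := by
  obtain ⟨hξ, hη, ⟨a, b, hx⟩, ⟨c, d, hy⟩, hm, hg⟩ := h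
  exact ⟨hη, hξ, ⟨b, a, hx.trans (mul_comm _ _)⟩, ⟨d, c, hy.trans (mul_comm _ _)⟩,
    fun j => (hm j).trans (mul_comm _ _), hg.swap⟩

/-- As x and y are Laurent monomials in the chart coordinates, the chart generates the whole
function field. -/
theorem isFractionRing {q : L × L} {e : Fin 4 → ℤ × ℤ} (h : IsMonomialChart x y m q e)
    (htop : IntermediateField.adjoin K {x, y, t} = ⊤) :
    IsFractionRing (coordinateChart K t q) L := by
  have h1 : q.1 ∈ IntermediateField.adjoin K {t, t⁻¹, q.1, q.2} :=
    IntermediateField.subset_adjoin _ _ (by simp)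
  have h2 : q.2 ∈ IntermediateField.adjoin K {t, t⁻¹, q.1, q.2} :=
    IntermediateField.subset_adjoin _ _ (by simp)
  have key : IntermediateField.adjoin K {t, t⁻¹, q.1, q.2} = ⊤ := by
    rw [eq_top_iff, ← htop, IntermediateField.adjoin_le_iff]
    rintro z (rfl | rfl | rfl)
    · obtain ⟨a, b, hx⟩ := h.x_eq
      rw [hx]
      exact mul_mem (zpow_mem h1 a) (zpow_mem h2 b)
    · obtain ⟨a, b, hy⟩ := h.y_eq
      rw [hy]
      exact mul_mem (zpow_mem h1 a) (zpow_mem h2 b)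
    · exact IntermediateField.subset_adjoin _ _ (by simp)
  refine IsFractionRing.of_field _ _ fun z => ?_
  have hz : z ∈ IntermediateField.adjoin K {t, t⁻¹, q.1, q.2} := by rw [key]; trivial
  obtain ⟨r, hr, s, hs, rfl⟩ := IntermediateField.mem_adjoin_iff_div.1 hz
  exact ⟨⟨r, hr⟩, ⟨s, hs⟩, rfl⟩

/-- Division of the equation by the smallest monomial. -/
theorem exists_nat_exponents {q : L × L} {e : Fin 4 → ℤ × ℤ} (h : IsMonomialChart x y m q e)
    {i : Fin 4} (hi : ∀ j, e i ≤ e j) (hrel : ∑ j : Fin 4, (if j = 3 then t else 1) * m j = 0) :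
    ∃ a b : Fin 4 → ℕ, (InGeneralPosition fun j => ((a j : ℤ), (b j : ℤ))) ∧ a i = 0 ∧ b i = 0 ∧
      ∑ j, (if j = 3 then t else 1) * (q.1 ^ a j * q.2 ^ b j) = 0 := by
  have ha : ∀ j, (((e j).1 - (e i).1).toNat : ℤ) = (e j).1 - (e i).1 := fun j =>
    Int.toNat_of_nonneg (sub_nonneg.2 (hi j).1)
  have hb : ∀ j, (((e j).2 - (e i).2).toNat : ℤ) = (e j).2 - (e i).2 := fun j =>
    Int.toNat_of_nonneg (sub_nonneg.2 (hi j).2)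
  refine ⟨fun j => ((e j).1 - (e i).1).toNat, fun j => ((e j).2 - (e i).2).toNat, ?_, by simp,
    by simp, ?_⟩
  · intro j k l hjk hjl hkl h0
    apply h.inGeneralPosition j k l hjk hjl hkl
    simp only [latticeCross, ha, hb] at h0 ⊢
    linear_combination h0
  · have h1 := zpow_ne_zero (e i).1 h.fst_ne_zero
    have h2 := zpow_ne_zero (e i).2 h.snd_ne_zero
    apply mul_left_cancel₀ (mul_ne_zero h1 h2)
    rw [mul_zero, ← hrel, Finset.mul_sum]
    refine Finset.sum_congr rfl fun j _ => ?_
    rw [h.monomial_eq j, ← zpow_natCast, ← zpow_natCast, ha, hb, zpow_sub₀ h.fst_ne_zero,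
      zpow_sub₀ h.snd_ne_zero]
    field_simp

end IsMonomialChart

theorem localRingAtCenter_rotate {t ξ η : L} (hξ : ξ ≠ 0) {O : ValuationSubring L} (h : ξ ∈ O)
    (h' : ξ⁻¹ ∈ O) :
    localRingAtCenter (coordinateChart K t (ξ, η)) O
      = localRingAtCenter (coordinateChart K t (ξ⁻¹, η * ξ⁻¹)) O := by
  have v := ValuationSubring.valuation_eq_one_of_mem_of_inv_mem hξ h h'
  have v' := ValuationSubring.valuation_eq_one_of_mem_of_inv_mem (inv_ne_zero hξ) h' (by simpa)
  have i₁ : ξ⁻¹ ∈ localSubalgebra (coordinateChart K t (ξ, η)) O :=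
    inv_mem_localSubalgebra fst_mem_localSubalgebra v
  have i₂ : ξ ∈ localSubalgebra (coordinateChart K t (ξ⁻¹, η * ξ⁻¹)) O := by
    simpa using inv_mem_localSubalgebra (K := K)
      (fst_mem_localSubalgebra (t := t) (q := (ξ⁻¹, η * ξ⁻¹))) v'
  refine localRingAtCenter_coordinateChart_eq i₂ ?_ i₁ (mul_mem snd_mem_localSubalgebra i₁)
  have := mul_mem (snd_mem_localSubalgebra (K := K) (t := t) (q := (ξ⁻¹, η * ξ⁻¹)) (O := O)) i₂
  simpa [mul_assoc, inv_mul_cancel₀ hξ] using this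

/-- A family of plane curves given by four monomials in general position has a semistable model. -/
theorem exists_semistable_model [IsAlgClosed K] [CharZero K] {x y t : L} (hx : x ≠ 0) (hy : y ≠ 0)
    (ht : t ≠ 0) (htop : IntermediateField.adjoin K {x, y, t} = ⊤) (e : Fin 4 → ℤ × ℤ)
    (he : InGeneralPosition e)
    (hrel : ∑ j : Fin 4, (if j = 3 then t else 1) * (x ^ (e j).1 * y ^ (e j).2) = 0) :
    ∃ (n : ℕ) (A : Fin n → Subalgebra K L), IsProperModel t A ∧ MapsToPlaneCurves x y A ∧
      ∀ t₀ : K, t₀ ≠ 0 → HasSemistableFiber t A t₀ := by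
  let m : Fin 4 → L := fun j => x ^ (e j).1 * y ^ (e j).2
  -- The three standard charts of the projective plane: (x, y), (1/x, y/x) and (1/y, x/y).
  have c₀ : IsMonomialChart x y m (x, y) e :=
    ⟨hx, hy, ⟨1, 0, by simp⟩, ⟨0, 1, by simp⟩, fun _ => rfl, he⟩
  have c₁ := c₀.rotate
  have c₂ := c₀.swap.rotate
  have step := fun q e' (h : IsMonomialChart x y m q e') =>
    exists_refinement (K := K) t (IsMonomialChart x y m)
    (fun q e h => ⟨h.fst_ne_zero, h.snd_ne_zero⟩) (fun _ _ _ h => h.blowUpFst)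
    (fun _ _ _ h => h.blowUpSnd) h
  obtain ⟨l₀, r₀, g₀⟩ := step _ _ c₀
  obtain ⟨l₁, r₁, g₁⟩ := step _ _ c₁
  obtain ⟨l₂, r₂, g₂⟩ := step _ _ c₂
  have mixed₀₁ : ∀ O : ValuationSubring L, ∀ r ∈ l₀, ∀ r' ∈ l₁,
      (∀ z ∈ coordinateChart K t r, z ∈ O) → (∀ z ∈ coordinateChart K t r', z ∈ O) →
      localRingAtCenter (coordinateChart K t r) O
        = localRingAtCenter (coordinateChart K t r') O := by
    intro O r hr r' hr' hO hO'
    have m1 : x ∈ O := r₀.fst_mem hr hO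
    have m2 : x⁻¹ ∈ O := r₁.fst_mem hr' hO'
    rw [r₀.localRing_eq O r hr hO (Or.inl m2), r₁.localRing_eq O r' hr' hO' (Or.inl (by simpa)),
      localRingAtCenter_rotate hx m1 m2]
  have mixed₀₂ : ∀ O : ValuationSubring L, ∀ r ∈ l₀, ∀ r' ∈ l₂,
      (∀ z ∈ coordinateChart K t r, z ∈ O) → (∀ z ∈ coordinateChart K t r', z ∈ O) →
      localRingAtCenter (coordinateChart K t r) O
        = localRingAtCenter (coordinateChart K t r') O := by
    intro O r hr r' hr' hO hO'
    have m1 : y ∈ O := r₀.snd_mem hr hO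
    have m2 : y⁻¹ ∈ O := r₂.fst_mem hr' hO'
    rw [r₀.localRing_eq O r hr hO (Or.inr m2), r₂.localRing_eq O r' hr' hO' (Or.inl (by simpa)),
      IsRefinement.coordinateChart_swap, localRingAtCenter_rotate hy m1 m2]
  -- On this overlap y/x is a unit, so the corners of both charts are avoided.
  have mixed₁₂ : ∀ O : ValuationSubring L, ∀ r ∈ l₁, ∀ r' ∈ l₂,
      (∀ z ∈ coordinateChart K t r, z ∈ O) → (∀ z ∈ coordinateChart K t r', z ∈ O) →
      localRingAtCenter (coordinateChart K t r) O
        = localRingAtCenter (coordinateChart K t r') O := by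
    intro O r hr r' hr' hO hO'
    have m1 : y * x⁻¹ ∈ O := r₁.snd_mem hr hO
    have m2 : x * y⁻¹ ∈ O := r₂.snd_mem hr' hO'
    have hinv : (y * x⁻¹)⁻¹ = x * y⁻¹ := by rw [mul_inv, inv_inv, mul_comm]
    have hinv' : (x * y⁻¹)⁻¹ = y * x⁻¹ := by rw [mul_inv, inv_inv, mul_comm]
    have hmul : x⁻¹ * (x * y⁻¹) = y⁻¹ := by rw [← mul_assoc, inv_mul_cancel₀ hx, one_mul]
    rw [r₁.localRing_eq O r hr hO (Or.inr (by rwa [hinv])),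
      r₂.localRing_eq O r' hr' hO' (Or.inr (by rwa [hinv'])), IsRefinement.coordinateChart_swap,
      localRingAtCenter_rotate (mul_ne_zero hy (inv_ne_zero hx)) m1 (by rwa [hinv]), hinv, hmul,
      IsRefinement.coordinateChart_swap]
  let l := l₀ ++ (l₁ ++ l₂)
  have hl : ∀ {r}, r ∈ l → r ∈ l₀ ∨ r ∈ l₁ ∨ r ∈ l₂ := fun hr => by simpa [l] using hr
  have good : ∀ r ∈ l, ∃ e', IsMonomialChart x y m r e' ∧ ∃ i, ∀ j, e' i ≤ e' j := by
    intro r hr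
    rcases hl hr with hr | hr | hr
    exacts [g₀ r hr, g₁ r hr, g₂ r hr]
  refine ⟨l.length, fun i => coordinateChart K t (l.get i), ⟨?_, ?_, ?_, ?_, ?_⟩, ?_, ?_⟩
  · exact fun i => adjoin_le_coordinateChart
  · exact fun i => coordinateChart_fg _ _
  · intro i
    obtain ⟨e', h, -⟩ := good _ (l.get_mem i)
    exact h.isFractionRing htop
  · intro O hO
    have : ∃ r ∈ l, r.1 ∈ O ∧ r.2 ∈ O := by
      have fin₀ : x ∈ O → y ∈ O → ∃ r ∈ l, r.1 ∈ O ∧ r.2 ∈ O := fun h1 h2 => by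
        obtain ⟨r, hr, h⟩ := r₀.exists_center O h1 h2
        exact ⟨r, by simp [l, hr], h⟩
      have fin₁ : x⁻¹ ∈ O → y * x⁻¹ ∈ O → ∃ r ∈ l, r.1 ∈ O ∧ r.2 ∈ O := fun h1 h2 => by
        obtain ⟨r, hr, h⟩ := r₁.exists_center O h1 h2
        exact ⟨r, by simp [l, hr], h⟩
      have fin₂ : y⁻¹ ∈ O → x * y⁻¹ ∈ O → ∃ r ∈ l, r.1 ∈ O ∧ r.2 ∈ O := fun h1 h2 => by
        obtain ⟨r, hr, h⟩ := r₂.exists_center O h1 h2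
        exact ⟨r, by simp [l, hr], h⟩
      -- Valuative criterion for the plane: the chart is that of the coordinate among 1, x, y of
      -- largest valuation.
      rcases O.mem_or_inv_mem (y * x⁻¹) with h | h
      · rcases O.mem_or_inv_mem x with h' | h'
        · refine fin₀ h' ?_
          simpa [hx] using O.mul_mem _ _ h h'
        · exact fin₁ h' h
      · rw [mul_inv, inv_inv, mul_comm] at h
        rcases O.mem_or_inv_mem y with h' | h'
        · refine fin₀ ?_ h'
          simpa [hy] using O.mul_mem _ _ h h'
        · exact fin₂ h' h
    obtain ⟨r, hr, h1, h2⟩ := this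
    obtain ⟨i, rfl⟩ := List.get_of_mem hr
    exact ⟨i, forall_mem_coordinateChart hO h1 h2⟩
  · intro O i j hi hj
    rcases hl (l.get_mem i) with h | h | h <;> rcases hl (l.get_mem j) with h' | h' | h'
    · exact r₀.center_unique O _ h _ h' hi hj
    · exact mixed₀₁ O _ h _ h' hi hj
    · exact mixed₀₂ O _ h _ h' hi hj
    · exact (mixed₀₁ O _ h' _ h hj hi).symm
    · exact r₁.center_unique O _ h _ h' hi hj
    · exact mixed₁₂ O _ h _ h' hi hj
    · exact (mixed₀₂ O _ h' _ h hj hi).symm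
    · exact (mixed₁₂ O _ h' _ h hj hi).symm
    · exact r₂.center_unique O _ h _ h' hi hj
  · intro i
    rcases hl (l.get_mem i) with h | h | h
    · exact .inl ⟨r₀.le _ h fst_mem_coordinateChart, r₀.le _ h snd_mem_coordinateChart⟩
    · exact .inr (.inl ⟨r₁.le _ h fst_mem_coordinateChart, r₁.le _ h snd_mem_coordinateChart⟩)
    · exact .inr (.inr ⟨r₂.le _ h fst_mem_coordinateChart, r₂.le _ h snd_mem_coordinateChart⟩)
  · intro t₀ ht₀ i p hp s hs hsp
    obtain ⟨e', h, k, hk⟩ := good _ (l.get_mem i)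
    obtain ⟨a, b, hab, ha, hb, hrel'⟩ := h.exists_nat_exponents hk hrel
    exact isSmooth_or_isOrdinaryDoublePoint_of_coordinateChart ht a b hab ha hb hrel' ht₀ p hs hsp

end SemistableModel

/-! ### The exponents of a Delsarte surface -/

namespace DelsarteSurface

variable {K : Type u} [Field K]

/-- The exponents of `x` and `y` in the `i`-th monomial, as a lattice point. -/
def latticePoint (S : DelsarteSurface K) (i : Fin 4) : ℤ × ℤ :=
  ((S.exponent i 0 : ℤ), (S.exponent i 1 : ℤ))

theorem latticePoint_inj {S : DelsarteSurface K} {i j : Fin 4}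
    (h : S.latticePoint i = S.latticePoint j) : S.xyExponent i = S.xyExponent j := by
  simpa [latticePoint, xyExponent] using h

theorem aeval_affineEquation {S : DelsarteSurface K} (hS : S.IsMinimal) {R : Type*} [CommRing R]
    [Algebra K R] (v : Fin 3 → R) :
    aeval v S.affineEquation = ∑ j : Fin 4, (if j = 3 then v 2 else 1) *
      (v 0 ^ S.exponent j 0 * v 1 ^ S.exponent j 1) := by
  simp only [affineEquation, equation, map_sum, map_mul, map_pow, aeval_X, hS.coeff_eq_one,
    Fin.prod_univ_four, hS.t_exponent, map_one, one_mul]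
  refine Finset.sum_congr rfl fun j _ => ?_
  split_ifs <;> simp
  ring

theorem eval_affineEquation {S : DelsarteSurface K} (hS : S.IsMinimal) (v : Fin 3 → K) :
    eval v S.affineEquation = ∑ j : Fin 4, (if j = 3 then v 2 else 1) *
      (v 0 ^ S.exponent j 0 * v 1 ^ S.exponent j 1) := by
  rw [← aeval_affineEquation hS, MvPolynomial.aeval_eq_eval]

/-- The t-column is (0, 0, 0, 1), and adding the other columns to the last makes it constant, so det
A is up to sign the degree times this area. -/
theorem latticeCross_ne_zero {S : DelsarteSurface K} (hS : S.IsMinimal) :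
    latticeCross (S.latticePoint 0) (S.latticePoint 1) (S.latticePoint 2) ≠ 0 := by
  intro h
  apply hS.det_ne_zero
  have hrow : ∀ i, (S.exponent i 3 : ℤ)
      = S.degree - S.exponent i 0 - S.exponent i 1 - S.exponent i 2 := by
    intro i
    have := S.row_sum i
    rw [Fin.sum_univ_four] at this
    omega
  have ht : ∀ i, (S.exponent i 2 : ℤ) = if i = 3 then 1 else 0 := by
    intro i
    rw [hS.t_exponent]
    split_ifs <;> rfl
  simp only [latticeCross, latticePoint] at h
  simp [Matrix.det_succ_row_zero, Fin.sum_univ_succ, Fin.succAbove, hrow, ht]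
  linear_combination -(S.degree : ℤ) * h

end DelsarteSurface

/-! ### Three collinear exponents -/

/-- Coordinates adapted to a line in the lattice: the last three points are moved to an axis and
the first one to the other axis. -/
theorem exists_adapted_basis {p₀ p₁ p₂ p₃ : ℤ × ℤ} (h : latticeCross p₀ p₁ p₂ ≠ 0)
    (h' : latticeCross p₃ p₁ p₂ = 0) (h₁ : p₃ ≠ p₁) (h₂ : p₃ ≠ p₂) :
    ∃ (u v r s w z : ℤ) (a b c d : ℕ), IsUnit (u * s - v * r) ∧ 0 < a ∧ b ≠ c ∧ b ≠ d ∧ c ≠ d ∧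
      p₀ = (a * r + w, a * s + z) ∧ p₁ = (b * u + w, b * v + z) ∧ p₂ = (c * u + w, c * v + z) ∧
      p₃ = (d * u + w, d * v + z) := by
  obtain ⟨x₀, y₀⟩ := p₀
  obtain ⟨x₁, y₁⟩ := p₁
  obtain ⟨x₂, y₂⟩ := p₂
  obtain ⟨x₃, y₃⟩ := p₃
  simp only [latticeCross] at h h'
  have hg : 0 < Int.gcd (x₂ - x₁) (y₂ - y₁) := by
    rw [Int.gcd_pos_iff]
    by_contra hc
    push Not at hc
    apply h
    linear_combination (y₀ - y₂) * hc.1 - (x₀ - x₂) * hc.2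
  -- (u, v) is the primitive direction of the line; the Bézout coefficients A, B below complete it
  -- to the lattice basis (u, v), (-B, A).
  obtain ⟨u, v, huv, hu, hv⟩ := Int.exists_gcd_one hg
  set g : ℤ := (Int.gcd (x₂ - x₁) (y₂ - y₁) : ℤ) with hgdef
  have hg0 : 0 < g := Int.natCast_pos.2 hg
  obtain ⟨A, B, hAB⟩ := Int.isCoprime_iff_gcd_eq_one.2 huv
  have hβ₀ : u * (y₀ - y₁) - v * (x₀ - x₁) ≠ 0 := by
    intro hc
    apply h
    have : (y₀ - y₂) * (x₂ - x₁) - (x₀ - x₂) * (y₂ - y₁) = 0 := by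
      rw [hu, hv]
      have e1 : y₂ = y₁ + v * g := by linear_combination hv
      have e2 : x₂ = x₁ + u * g := by linear_combination hu
      rw [e1, e2]
      linear_combination g * hc
    linear_combination this
  have hβ₃ : u * (y₃ - y₁) - v * (x₃ - x₁) = 0 := by
    have : g * (u * (y₃ - y₁) - v * (x₃ - x₁)) = 0 := by
      linear_combination h' - (y₃ - y₁) * hu + (x₃ - x₁) * hv
    exact (mul_eq_zero.1 this).resolve_left hg0.ne'
  -- The exponent a is the lattice distance of p₀ from the line, and ε the side on which p₀ lies.
  obtain ⟨ε, a, hε, ha, ha0⟩ : ∃ (ε : ℤ) (a : ℕ), ε * ε = 1 ∧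
      (a : ℤ) = ε * (u * (y₀ - y₁) - v * (x₀ - x₁)) ∧ 0 < a := by
    generalize u * (y₀ - y₁) - v * (x₀ - x₁) = β at hβ₀
    rcases lt_or_gt_of_ne hβ₀ with hneg | hpos
    · exact ⟨-1, β.natAbs, by norm_num, by omega, by omega⟩
    · exact ⟨1, β.natAbs, by norm_num, by omega, by omega⟩
  set α₀ := (x₀ - x₁) * A + (y₀ - y₁) * B with hα₀
  set α₃ := (x₃ - x₁) * A + (y₃ - y₁) * B with hα₃
  have ex₀ : x₀ = x₁ + α₀ * u - (u * (y₀ - y₁) - v * (x₀ - x₁)) * B := by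
    rw [hα₀]; linear_combination -(x₀ - x₁) * hAB
  have ey₀ : y₀ = y₁ + α₀ * v + (u * (y₀ - y₁) - v * (x₀ - x₁)) * A := by
    rw [hα₀]; linear_combination -(y₀ - y₁) * hAB
  have ex₃ : x₃ = x₁ + α₃ * u := by
    rw [hα₃]; linear_combination -(x₃ - x₁) * hAB - B * hβ₃
  have ey₃ : y₃ = y₁ + α₃ * v := by
    rw [hα₃]; linear_combination -(y₃ - y₁) * hAB + A * hβ₃
  have hβa : u * (y₀ - y₁) - v * (x₀ - x₁) = a * ε := by
    rw [ha]; linear_combination -(u * (y₀ - y₁) - v * (x₀ - x₁)) * hε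
  rw [hβa] at ex₀ ey₀
  -- Adding N(u, v) to the second basis vector shifts the positions on the line by aN, which makes
  -- b, c, d nonnegative.
  obtain ⟨N, hN⟩ : ∃ N : ℤ, |α₀| + |α₃| + g ≤ a * N := by
    refine ⟨|α₀| + |α₃| + g, le_mul_of_one_le_left (by positivity) (by exact_mod_cast ha0)⟩
  have b₀ := le_abs_self α₀
  have b₃ := neg_abs_le α₃
  have b₃' := abs_nonneg α₃
  obtain ⟨b, hb⟩ := Int.eq_ofNat_of_zero_le (a := a * N - α₀) (by linarith)
  obtain ⟨c, hc⟩ := Int.eq_ofNat_of_zero_le (a := g + (a * N - α₀)) (by linarith)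
  obtain ⟨d, hd⟩ := Int.eq_ofNat_of_zero_le (a := α₃ + (a * N - α₀)) (by linarith)
  refine ⟨u, v, -ε * B + N * u, ε * A + N * v, x₁ + (α₀ - a * N) * u, y₁ + (α₀ - a * N) * v,
    a, b, c, d, ?_, ha0, ?_, ?_, ?_, ?_, ?_, ?_, ?_⟩
  · have : u * (ε * A + N * v) - v * (-ε * B + N * u) = ε := by linear_combination ε * hAB
    rw [this]
    exact IsUnit.of_mul_eq_one ε hε
  · rintro rfl
    omega
  · rintro rfl
    have : α₃ = 0 := by omega
    apply h₁
    rw [ex₃, ey₃, this]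
    simp
  · rintro rfl
    have : α₃ = g := by omega
    apply h₂
    rw [ex₃, ey₃, this]
    ext
    · linear_combination -hu
    · linear_combination -hv
  · ext
    · linear_combination ex₀
    · linear_combination ey₀
  · ext
    · rw [← hb]; ring
    · rw [← hb]; ring
  · ext
    · rw [← hc]; linear_combination hu
    · rw [← hc]; linear_combination hv
  · ext
    · rw [← hd]; linear_combination ex₃
    · rw [← hd]; linear_combination ey₃

namespace DelsarteSurface

variable {K : Type u} [Field K]

/-- The Delsarte surface `y ^ a + x ^ b + x ^ c + t * x ^ d = 0`. -/
def superelliptic (K : Type u) [Field K] (a b c d : ℕ) : DelsarteSurface K where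
  coeff _ := 1
  coeff_ne_zero _ := one_ne_zero
  -- The last column homogenizes every term to the degree a + b + c + d + 1.
  exponent := !![0, a, 0, b + c + d + 1; b, 0, 0, a + c + d + 1; c, 0, 0, a + b + d + 1;
    d, 0, 1, a + b + c]
  degree := a + b + c + d + 1
  row_sum := by
    intro i
    fin_cases i <;> simp [Fin.sum_univ_four] <;> ring

theorem affineEquation_superelliptic (a b c d : ℕ) :
    (superelliptic K a b c d).affineEquation = X 1 ^ a + (X 0 ^ b + X 0 ^ c + X 2 * X 0 ^ d) := by
  simp [affineEquation, equation, superelliptic, Fin.sum_univ_four, Fin.prod_univ_four]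
  ring

/-- If `m₄` is on the line through two of the other exponents, the surface is birational to
`y ^ a + x ^ b + x ^ c + t * x ^ d = 0`. -/
theorem isDelsarteBirational_superelliptic {S : DelsarteSurface K} (hS : S.IsMinimal)
    {i j k : Fin 4} (hi : i ≠ 3) (hj : j ≠ 3) (hk : k ≠ 3)
    (hsum : ∀ F : Fin 4 → K, ∑ l, F l = F i + F j + F k + F 3)
    {u v r s w z : ℤ} {a b c d : ℕ} (hdet : IsUnit (u * s - v * r))
    (ei : S.latticePoint i = (a * r + w, a * s + z))
    (ej : S.latticePoint j = (b * u + w, b * v + z))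
    (ek : S.latticePoint k = (c * u + w, c * v + z))
    (e3 : S.latticePoint 3 = (d * u + w, d * v + z)) :
    S.IsDelsarteBirational (superelliptic K a b c d) := by
  refine ⟨!![u, v, 0; r, s, 0; 0, 0, 1], ?_, ?_, fun p => ?_⟩
  · convert hdet using 1
    simp [Matrix.det_fin_three]
  · ext l
    fin_cases l <;> rfl
  · have hp0 : (p 0 : K) ≠ 0 := (p 0).ne_zero
    have hp1 : (p 1 : K) ≠ 0 := (p 1).ne_zero
    have mono : ∀ l (n : ℕ) (g h : ℤ), S.latticePoint l = (n * g + w, n * h + z) →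
        (p 0 : K) ^ S.exponent l 0 * (p 1 : K) ^ S.exponent l 1
          = ((p 0 : K) ^ w * (p 1 : K) ^ z) * ((p 0 : K) ^ g * (p 1 : K) ^ h) ^ n := by
      intro l n g h hl
      simp only [latticePoint, Prod.mk.injEq] at hl
      rw [← zpow_natCast, ← zpow_natCast (p 1 : K), hl.1, hl.2, zpow_add₀ hp0, zpow_add₀ hp1,
        mul_pow, mul_comm (n : ℤ), mul_comm (n : ℤ), zpow_mul, zpow_mul, zpow_natCast, zpow_natCast]
      ring
    have hW : (p 0 : K) ^ w * (p 1 : K) ^ z ≠ 0 :=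
      mul_ne_zero (zpow_ne_zero _ hp0) (zpow_ne_zero _ hp1)
    -- The two equations differ by the monomial x^w y^z, which is invertible on the torus.
    have key : eval (fun i => (p i : K)) S.affineEquation = ((p 0 : K) ^ w * (p 1 : K) ^ z) *
        eval (fun i => (monomialMap !![u, v, 0; r, s, 0; 0, 0, 1] p i : K))
          (superelliptic K a b c d).affineEquation := by
      rw [eval_affineEquation hS, hsum, affineEquation_superelliptic, mono i a r s ei,
        mono j b u v ej, mono k c u v ek, mono 3 d u v e3]
      simp [hi, hj, hk, monomialMap, Fin.prod_univ_three]
      ring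
    rw [key, mul_eq_zero]
    simp only [hW, false_or]

/-- If `m₄` is not equal to one of the other monomials and the exponents are not in general
position, then the surface is birational to one of the form `y ^ a + x ^ b + x ^ c + t * x ^ d`. -/
theorem exists_superelliptic {S : DelsarteSurface K} (hS : S.IsMinimal)
    (hne : ∀ i, i ≠ 3 → S.latticePoint 3 ≠ S.latticePoint i)
    (hgen : ¬ InGeneralPosition S.latticePoint) :
    ∃ (S' : DelsarteSurface K) (a b c d : ℕ), 0 < a ∧ b ≠ c ∧ b ≠ d ∧ c ≠ d ∧
      S'.affineEquation = X 1 ^ a + (X 0 ^ b + X 0 ^ c + X 2 * X 0 ^ d) ∧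
      S.IsDelsarteBirational S' := by
  have hcross := latticeCross_ne_zero hS
  have of_collinear : ∀ i j k : Fin 4, i ≠ 3 → j ≠ 3 → k ≠ 3 →
      (∀ F : Fin 4 → K, ∑ l, F l = F i + F j + F k + F 3) →
      latticeCross (S.latticePoint i) (S.latticePoint j) (S.latticePoint k) ≠ 0 →
      latticeCross (S.latticePoint 3) (S.latticePoint j) (S.latticePoint k) = 0 →
      ∃ (S' : DelsarteSurface K) (a b c d : ℕ), 0 < a ∧ b ≠ c ∧ b ≠ d ∧ c ≠ d ∧
        S'.affineEquation = X 1 ^ a + (X 0 ^ b + X 0 ^ c + X 2 * X 0 ^ d) ∧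
        S.IsDelsarteBirational S' := by
    intro i j k hi hj hk hsum h h'
    obtain ⟨u, v, r, s, w, z, a, b, c, d, hdet, ha, hbc, hbd, hcd, e0, e1, e2, e3⟩ :=
      exists_adapted_basis h h' (hne j hj) (hne k hk)
    exact ⟨superelliptic K a b c d, a, b, c, d, ha, hbc, hbd, hcd,
      affineEquation_superelliptic a b c d,
      isDelsarteBirational_superelliptic hS hi hj hk hsum hdet e0 e1 e2 e3⟩
  by_contra hcon
  apply hgen
  -- A collinear triple must contain the fourth point, so only the lines through two of the first
  -- three have to be excluded.
  have h0 := fun h => hcon (of_collinear 0 1 2 (by decide) (by decide) (by decide)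
    (fun F => by rw [Fin.sum_univ_four]) hcross h)
  have h1 := fun h => hcon (of_collinear 1 0 2 (by decide) (by decide) (by decide)
    (fun F => by rw [Fin.sum_univ_four]; ring)
    (fun h => hcross (by simp only [latticeCross] at h ⊢; linear_combination -h)) h)
  have h2 := fun h => hcon (of_collinear 2 0 1 (by decide) (by decide) (by decide)
    (fun F => by rw [Fin.sum_univ_four]; ring)
    (fun h => hcross (by simp only [latticeCross] at h ⊢; linear_combination h)) h)
  clear hcon of_collinear hne hgen
  intro i j k hij hik hjk h
  simp only [latticeCross] at hcross h0 h1 h2 h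
  fin_cases i <;> fin_cases j <;> fin_cases k <;>
    try first | exact hij rfl | exact hik rfl | exact hjk rfl
  all_goals simp only [Fin.zero_eta, Fin.mk_one, Fin.reduceFinMk] at h
  all_goals first
    | exact hcross (by linear_combination h)
    | exact hcross (by linear_combination -h)
    | exact h0 (by linear_combination h)
    | exact h0 (by linear_combination -h)
    | exact h1 (by linear_combination h)
    | exact h1 (by linear_combination -h)
    | exact h2 (by linear_combination h)
    | exact h2 (by linear_combination -h)

end DelsarteSurface

/-! ### The isotrivial case -/

/-- A field generated by two algebraically dependent elements, not both algebraic, has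
transcendence degree one. -/
theorem trdeg_adjoin_pair_eq_one {K : Type u} {E : Type v} [Field K] [Field E] [Algebra K E]
    {x y : E} {G : MvPolynomial (Fin 2) K} (hG : G ≠ 0) (hG0 : aeval ![x, y] G = 0)
    (h : ¬ (IsAlgebraic K x ∧ IsAlgebraic K y)) :
    Algebra.trdeg K (IntermediateField.adjoin K {x, y}) = 1 := by
  set C := IntermediateField.adjoin K {x, y} with hC
  let x' : C := ⟨x, IntermediateField.subset_adjoin _ _ (by simp)⟩
  let y' : C := ⟨y, IntermediateField.subset_adjoin _ _ (by simp)⟩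
  have hmap : Algebra.adjoin K {x, y} = (Algebra.adjoin K {x', y'}).map C.val := by
    rw [AlgHom.map_adjoin, Set.image_pair]
    rfl
  have : Algebra.IsAlgebraic (Algebra.adjoin K {x', y'}) C := by
    constructor
    rintro ⟨z, hz⟩
    obtain ⟨r, hr, s, hs, rfl⟩ := IntermediateField.mem_adjoin_iff_div.1 hz
    rw [hmap] at hr hs
    obtain ⟨r', hr', rfl⟩ := hr
    obtain ⟨s', hs', rfl⟩ := hs
    have := (isAlgebraic_algebraMap (A := C) (⟨r', hr'⟩ : Algebra.adjoin K {x', y'})).mul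
      (isAlgebraic_algebraMap (A := C) (⟨s', hs'⟩ : Algebra.adjoin K {x', y'})).inv
    have e : (⟨C.val r' / C.val s', hz⟩ : C) = r' * s'⁻¹ := Subtype.ext (div_eq_mul_inv _ _)
    exact e ▸ this
  -- A transcendence basis is chosen among the two generators: it is not empty by `h`, and does not
  -- have two elements because of `G`.
  obtain ⟨B, hB, hbasis⟩ := exists_isTranscendenceBasis_subset (R := K) ({x', y'} : Set C)
  rw [← hbasis.cardinalMk_eq_trdeg, Cardinal.mk_set_eq_one_iff]
  have hne : B.Nonempty := by
    rw [Set.nonempty_iff_ne_empty]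
    rintro rfl
    have halg := hbasis.isEmpty_iff_isAlgebraic.1 inferInstance
    exact h ⟨IsAlgebraic.algHom C.val (halg.isAlgebraic x'),
      IsAlgebraic.algHom C.val (halg.isAlgebraic y')⟩
  rcases Set.subset_pair_iff_eq.1 hB with rfl | rfl | rfl | rfl
  · simp at hne
  · exact ⟨x', rfl⟩
  · exact ⟨y', rfl⟩
  · by_cases hxy : x' = y'
    · exact ⟨x', by simp [hxy]⟩
    · exfalso
      apply hG
      have hind := hbasis.1.comp (![⟨x', by simp⟩, ⟨y', by simp⟩] : Fin 2 → ({x', y'} : Set C)) (by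
        intro i j hij
        fin_cases i <;> fin_cases j
        · rfl
        · exact absurd (congrArg Subtype.val hij) hxy
        · exact absurd (congrArg Subtype.val hij).symm hxy
        · rfl)
      have hcomp : ((↑) : ({x', y'} : Set C) → C) ∘ (![⟨x', by simp⟩, ⟨y', by simp⟩] :
          Fin 2 → ({x', y'} : Set C)) = ![x', y'] := by
        ext i; fin_cases i <;> rfl
      rw [hcomp] at hind
      refine (injective_iff_map_eq_zero _).1 hind G (Subtype.ext ?_)
      have hv : (![x, y] : Fin 2 → E) = fun i => C.val (![x', y'] i) := by
        ext i; fin_cases i <;> rfl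
      rw [hv, ← MvPolynomial.comp_aeval_apply] at hG0
      exact hG0

namespace DelsarteSurface

variable {K : Type u} [Field K] {L : Type v} [Field L] [Algebra K L]
  {S : DelsarteSurface K} {x y t : L}

/-- A relation in the function field is a multiple of f, so it can be refuted at a single point of
the surface. -/
theorem IsFunctionField.eval_eq_zero (hL : S.IsFunctionField x y t) {G : MvPolynomial (Fin 3) K}
    (hG : aeval ![x, y, t] G = 0) {v : Fin 3 → K} (hv : eval v S.affineEquation = 0) :
    eval v G = 0 := by
  have hmem : G ∈ RingHom.ker (aeval ![x, y, t] : MvPolynomial (Fin 3) K →ₐ[K] L) := hG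
  rw [hL.ker_eq, Ideal.mem_span_singleton] at hmem
  obtain ⟨H, rfl⟩ := hmem
  rw [map_mul, hv, zero_mul]

theorem IsFunctionField.aeval_eq_zero (hL : S.IsFunctionField x y t) :
    aeval ![x, y, t] S.affineEquation = 0 := by
  have : S.affineEquation ∈ RingHom.ker (aeval ![x, y, t] : MvPolynomial (Fin 3) K →ₐ[K] L) := by
    rw [hL.ker_eq]
    exact Ideal.mem_span_singleton_self _
  exact this

/-- At x = y = 1 all monomials equal 1, so this test point works whatever the exponents are. -/
theorem eval_affineEquation_one_one (hS : S.IsMinimal) :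
    eval ![1, 1, -3] S.affineEquation = 0 := by
  rw [eval_affineEquation hS, Fin.sum_univ_four]
  simp
  norm_num

theorem IsFunctionField.ne_zero (hS : S.IsMinimal) (hL : S.IsFunctionField x y t)
    {G : MvPolynomial (Fin 3) K} (hG : eval ![1, 1, -3] G ≠ 0) : aeval ![x, y, t] G ≠ 0 :=
  fun h => hG (hL.eval_eq_zero h (eval_affineEquation_one_one hS))

theorem IsFunctionField.x_ne_zero (hS : S.IsMinimal) (hL : S.IsFunctionField x y t) : x ≠ 0 := by
  simpa using hL.ne_zero hS (G := X 0) (by simp)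

theorem IsFunctionField.y_ne_zero (hS : S.IsMinimal) (hL : S.IsFunctionField x y t) : y ≠ 0 := by
  simpa using hL.ne_zero hS (G := X 1) (by simp)

theorem IsFunctionField.t_ne_zero [CharZero K] (hS : S.IsMinimal) (hL : S.IsFunctionField x y t) :
    t ≠ 0 := by
  simpa using hL.ne_zero hS (G := X 2) (by simp)

theorem IsFunctionField.one_add_t_ne_zero [CharZero K] (hS : S.IsMinimal)
    (hL : S.IsFunctionField x y t) : 1 + t ≠ 0 := by
  have := hL.ne_zero hS (G := 1 + X 2) (by simp; norm_num)
  rwa [map_add, map_one, aeval_X] at this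

/-- If `m₄ = m i`, no relation `r * (1 + t) * m i = r' * m j` with constants `r ≠ 0`, `r'` holds on
the surface. -/
theorem IsFunctionField.mul_monomial_ne [CharZero K] (hS : S.IsMinimal)
    (hL : S.IsFunctionField x y t) {i j k : Fin 4} (hi : i ≠ 3) (hj : j ≠ 3) (hk : k ≠ 3)
    (hsum : ∀ F : Fin 4 → K, ∑ l, F l = F i + F j + F k + F 3)
    (h0 : S.exponent 3 0 = S.exponent i 0) (h1 : S.exponent 3 1 = S.exponent i 1)
    (hjk : S.latticePoint j ≠ S.latticePoint k) {r r' : K} (hr : r ≠ 0) :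
    algebraMap K L r * ((1 + t) * (x ^ S.exponent i 0 * y ^ S.exponent i 1))
      ≠ algebraMap K L r' * (x ^ S.exponent j 0 * y ^ S.exponent j 1) := by
  intro h
  have hG : aeval ![x, y, t] (C r * ((1 + X 2) * (X 0 ^ S.exponent i 0 * X 1 ^ S.exponent i 1))
      - C r' * (X 0 ^ S.exponent j 0 * X 1 ^ S.exponent j 1)) = 0 := by
    simpa [sub_eq_zero, MvPolynomial.algebraMap_eq] using h
  have key : ∀ a b : K, a ≠ 0 → b ≠ 0 →
      -r * (a ^ S.exponent j 0 * b ^ S.exponent j 1 + a ^ S.exponent k 0 * b ^ S.exponent k 1)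
        = r' * (a ^ S.exponent j 0 * b ^ S.exponent j 1) := by
    intro a b ha hb
    have hm : a ^ S.exponent i 0 * b ^ S.exponent i 1 ≠ 0 :=
      mul_ne_zero (pow_ne_zero _ ha) (pow_ne_zero _ hb)
    set mi := a ^ S.exponent i 0 * b ^ S.exponent i 1
    set mj := a ^ S.exponent j 0 * b ^ S.exponent j 1
    set mk := a ^ S.exponent k 0 * b ^ S.exponent k 1
    -- The equation is linear in t, so every (a, b) in the torus lifts to a point of the surface.
    have hv : eval ![a, b, -1 - (mj + mk) / mi] S.affineEquation = 0 := by
      rw [eval_affineEquation hS, hsum]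
      simp only [hi, hj, hk, h0, h1, if_false, if_true]
      show 1 * mi + 1 * mj + 1 * mk + (-1 - (mj + mk) / mi) * mi = 0
      field_simp
      ring
    have := hL.eval_eq_zero hG hv
    simp only [map_sub, map_mul, map_add, map_one, map_pow, eval_C, eval_X] at this
    change r * ((1 + (-1 - (mj + mk) / mi)) * mi) - r' * mj = 0 at this
    field_simp at this
    linear_combination this
  have hr' : r' = -2 * r := by
    have := key 1 1 one_ne_zero one_ne_zero
    simp only [one_pow] at this
    linear_combination -this
  have key' : ∀ a b : K, a ≠ 0 → b ≠ 0 →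
      a ^ S.exponent j 0 * b ^ S.exponent j 1 = a ^ S.exponent k 0 * b ^ S.exponent k 1 := by
    intro a b ha hb
    have := key a b ha hb
    apply mul_left_cancel₀ hr
    rw [hr'] at this
    linear_combination this
  apply hjk
  -- Powers of 2 are injective in the exponent, so two evaluations recover both exponents.
  have e0 := key' 2 1 two_ne_zero one_ne_zero
  have e1 := key' 1 2 one_ne_zero two_ne_zero
  simp only [one_pow, mul_one, one_mul] at e0 e1
  have e0' : 2 ^ S.exponent j 0 = 2 ^ S.exponent k 0 := by exact_mod_cast e0
  have e1' : 2 ^ S.exponent j 1 = 2 ^ S.exponent k 1 := by exact_mod_cast e1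
  simp [latticePoint, Nat.pow_right_injective le_rfl e0', Nat.pow_right_injective le_rfl e1']

end DelsarteSurface

/-- An integral weight that separates `p₀` from the parallel line through `p₁` and `p₂`. -/
theorem exists_weight {p₀ p₁ p₂ : ℤ × ℤ} (h : latticeCross p₀ p₁ p₂ ≠ 0) :
    ∃ (n : ℕ) (a b c : ℤ), 0 < n ∧ a * p₁.1 + b * p₁.2 = c ∧ a * p₂.1 + b * p₂.2 = c ∧
      a * p₀.1 + b * p₀.2 = c + n := by
  obtain ⟨σ, n, hn, hn0⟩ : ∃ (σ : ℤ) (n : ℕ), (n : ℤ) = σ * latticeCross p₀ p₁ p₂ ∧ 0 < n := by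
    rcases lt_or_gt_of_ne h with h' | h'
    · exact ⟨-1, (latticeCross p₀ p₁ p₂).natAbs, by omega, by omega⟩
    · exact ⟨1, (latticeCross p₀ p₁ p₂).natAbs, by omega, by omega⟩
  -- The weight is the normal vector of the line through p₁ and p₂, with the sign σ that makes n
  -- positive.
  refine ⟨n, σ * (p₁.2 - p₂.2), σ * (p₂.1 - p₁.1), _, hn0, rfl, by ring, ?_⟩
  rw [hn, latticeCross]
  ring

namespace DelsarteSurface

variable {K : Type u} [Field K] [IsAlgClosed K] [CharZero K] {L : Type v} [Field L] [Algebra K L]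
  {S : DelsarteSurface K} {x y t : L}

/-- With sⁿ = 1 + t and the weight (a, b), the elements x' = sᵃx and y' = sᵇy satisfy mᵢ + mⱼ + mₖ =
0, an equation without t. So C = K(x', y') and B = K(t, s) serve as the constant curve and the base
extension. -/
theorem IsFunctionField.isIsotrivial (hS : S.IsMinimal)
    (hL : S.IsFunctionField x y t) {i j k : Fin 4} (hi : i ≠ 3) (hj : j ≠ 3) (hk : k ≠ 3)
    (hsumK : ∀ F : Fin 4 → K, ∑ l, F l = F i + F j + F k + F 3)
    (hsumL : ∀ F : Fin 4 → L, ∑ l, F l = F i + F j + F k + F 3)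
    (h0 : S.exponent 3 0 = S.exponent i 0) (h1 : S.exponent 3 1 = S.exponent i 1)
    (hcross : latticeCross (S.latticePoint i) (S.latticePoint j) (S.latticePoint k) ≠ 0) :
    IsIsotrivial K t := by
  have hx := hL.x_ne_zero hS
  have hy := hL.y_ne_zero hS
  have hτ := hL.one_add_t_ne_zero hS
  set φ := algebraMap L (AlgebraicClosure L) with hφ
  obtain ⟨n, a, b, c, hn, cj, ck, ci⟩ := exists_weight hcross
  obtain ⟨s, hs⟩ := IsAlgClosed.exists_pow_nat_eq (φ (1 + t)) hn
  have hs0 : s ≠ 0 := by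
    rintro rfl
    rw [zero_pow hn.ne', eq_comm, map_eq_zero] at hs
    exact hτ hs
  have hφx : φ x ≠ 0 := by simpa using hx
  have hφy : φ y ≠ 0 := by simpa using hy
  set x' := s ^ a * φ x with hx'
  set y' := s ^ b * φ y with hy'
  have hmono : ∀ l, x' ^ S.exponent l 0 * y' ^ S.exponent l 1
      = s ^ (a * (S.latticePoint l).1 + b * (S.latticePoint l).2)
        * φ (x ^ S.exponent l 0 * y ^ S.exponent l 1) := by
    intro l
    rw [hx', hy', mul_pow, mul_pow, zpow_add₀ hs0, zpow_mul, zpow_mul]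
    simp only [latticePoint, zpow_natCast, map_mul, map_pow]
    ring
  have hmi := hmono i
  have hmj := hmono j
  have hmk := hmono k
  rw [ci, zpow_add₀ hs0, zpow_natCast, hs] at hmi
  rw [cj] at hmj
  rw [ck] at hmk
  have hrel : (1 + t) * (x ^ S.exponent i 0 * y ^ S.exponent i 1)
      + x ^ S.exponent j 0 * y ^ S.exponent j 1 + x ^ S.exponent k 0 * y ^ S.exponent k 1 = 0 := by
    have := hL.aeval_eq_zero
    rw [aeval_affineEquation hS, hsumL] at this
    simp only [hi, hj, hk, h0, h1, if_false, if_true, one_mul] at this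
    change x ^ S.exponent i 0 * y ^ S.exponent i 1 + x ^ S.exponent j 0 * y ^ S.exponent j 1
      + x ^ S.exponent k 0 * y ^ S.exponent k 1 + t * (x ^ S.exponent i 0 * y ^ S.exponent i 1) = 0
      at this
    linear_combination this
  set F := IntermediateField.adjoin K {φ t} with hF
  have hsint : IsIntegral F s := by
    refine IsIntegral.of_pow hn ?_
    rw [hs]
    have hmem : φ (1 + t) ∈ F := by
      rw [map_add, map_one]
      exact add_mem (one_mem _) (IntermediateField.subset_adjoin _ _ rfl)
    exact isIntegral_algebraMap (R := F) (x := ⟨_, hmem⟩)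
  let B := (IntermediateField.adjoin F {s}).restrictScalars K
  let C := IntermediateField.adjoin K {x', y'}
  have hFB : F ≤ B := fun z hz => (IntermediateField.adjoin F {s}).algebraMap_mem ⟨z, hz⟩
  have hsB : s ∈ B := IntermediateField.subset_adjoin F {s} rfl
  refine ⟨B, C, hFB, ?_, IntermediateField.fg_adjoin_of_finite (by simp), ?_, ?_⟩
  · have : IntermediateField.extendScalars hFB = IntermediateField.adjoin F {s} := rfl
    rw [this]
    exact IntermediateField.adjoin.finiteDimensional hsint
  · refine trdeg_adjoin_pair_eq_one
      (G := X 0 ^ S.exponent i 0 * X 1 ^ S.exponent i 1 + X 0 ^ S.exponent j 0 * X 1 ^ S.exponent j 1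
        + X 0 ^ S.exponent k 0 * X 1 ^ S.exponent k 1) ?_ ?_ ?_
    · intro hG
      have := congrArg (eval ![(1 : K), 1]) hG
      simp at this
      norm_num at this
    · simp only [map_add, map_mul, map_pow, aeval_X]
      change x' ^ S.exponent i 0 * y' ^ S.exponent i 1 + x' ^ S.exponent j 0 * y' ^ S.exponent j 1
        + x' ^ S.exponent k 0 * y' ^ S.exponent k 1 = 0
      rw [hmi, hmj, hmk]
      have := congrArg φ hrel
      simp only [map_add, map_mul, map_zero] at this ⊢
      linear_combination s ^ c * this
    -- If both were algebraic they would be constants in K, making (1 + t) mᵢ and mⱼ proportional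
    -- over K.
    · rintro ⟨hxa, hya⟩
      have const : ∀ z : AlgebraicClosure L, IsAlgebraic K z → ∃ r : K, algebraMap K _ r = z := by
        intro z hz
        have hmem := IntermediateField.mem_bot.1
          (show z ∈ (⊥ : IntermediateField K (AlgebraicClosure L)) from ?_)
        · exact hmem
        · have := IsAlgClosed.algebraMap_bijective_of_isIntegral (k := K)
            (K := algebraicClosure K (AlgebraicClosure L))
          obtain ⟨r, hr⟩ := this.2 ⟨z, mem_algebraicClosure_iff.2 hz⟩
          exact ⟨r, congrArg Subtype.val hr⟩
      obtain ⟨ξ, hξ⟩ := const x' hxa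
      obtain ⟨η, hη⟩ := const y' hya
      have hξ0 : ξ ≠ 0 := by
        rintro rfl
        rw [map_zero] at hξ
        exact mul_ne_zero (zpow_ne_zero a hs0) hφx hξ.symm
      have hη0 : η ≠ 0 := by
        rintro rfl
        rw [map_zero] at hη
        exact mul_ne_zero (zpow_ne_zero b hs0) hφy hη.symm
      have hjk : S.latticePoint j ≠ S.latticePoint k := by
        intro hjk
        apply hcross
        rw [hjk, latticeCross]
        ring
      refine hL.mul_monomial_ne hS hi hj hk hsumK h0 h1 hjk
        (r := ξ ^ S.exponent j 0 * η ^ S.exponent j 1)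
        (r' := ξ ^ S.exponent i 0 * η ^ S.exponent i 1)
        (mul_ne_zero (pow_ne_zero _ hξ0) (pow_ne_zero _ hη0)) ?_
      apply φ.injective
      have hφK : ∀ r : K, φ (algebraMap K L r) = algebraMap K (AlgebraicClosure L) r := fun r =>
        (IsScalarTower.algebraMap_apply K L (AlgebraicClosure L) r).symm
      apply mul_left_cancel₀ (zpow_ne_zero c hs0)
      rw [map_mul φ (algebraMap K L _), map_mul φ (algebraMap K L _), hφK, hφK]
      simp only [map_mul (algebraMap K (AlgebraicClosure L)), map_pow (algebraMap K _), hξ, hη]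
      rw [hmi, hmj]
      rw [map_mul φ (1 + t)]
      ring
  · have hrange : (IsScalarTower.toAlgHom K L (AlgebraicClosure L)).fieldRange
        = IntermediateField.adjoin K {φ x, φ y, φ t} := by
      rw [AlgHom.fieldRange_eq_map, ← hL.adjoin_eq_top, IntermediateField.adjoin_map]
      congr 1
      simp only [Set.image_insert_eq, Set.image_singleton]
      rfl
    rw [hrange]
    apply le_antisymm
    · refine sup_le ?_ le_sup_right
      rw [IntermediateField.adjoin_le_iff]
      have hsm : s ∈ C ⊔ B := (le_sup_right : B ≤ C ⊔ B) hsB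
      rintro z (rfl | rfl | rfl)
      · have hxm : x' ∈ C ⊔ B := (le_sup_left : C ≤ C ⊔ B)
          (IntermediateField.subset_adjoin _ _ (by simp))
        have := mul_mem (inv_mem (zpow_mem hsm a)) hxm
        rwa [hx', inv_mul_cancel_left₀ (zpow_ne_zero a hs0)] at this
      · have hym : y' ∈ C ⊔ B := (le_sup_left : C ≤ C ⊔ B)
          (IntermediateField.subset_adjoin _ _ (by simp))
        have := mul_mem (inv_mem (zpow_mem hsm b)) hym
        rwa [hy', inv_mul_cancel_left₀ (zpow_ne_zero b hs0)] at this
      · exact (le_sup_right : B ≤ C ⊔ B) (hFB (IntermediateField.subset_adjoin _ _ rfl))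
    · refine sup_le ?_ le_sup_right
      rw [IntermediateField.adjoin_le_iff]
      set D := IntermediateField.adjoin K {φ x, φ y, φ t}
      have hsm : s ∈ D ⊔ B := (le_sup_right : B ≤ D ⊔ B) hsB
      rintro z (rfl | rfl)
      · exact mul_mem (zpow_mem hsm a) ((le_sup_left : D ≤ D ⊔ B)
          (IntermediateField.subset_adjoin _ _ (by simp)))
      · exact mul_mem (zpow_mem hsm b) ((le_sup_left : D ≤ D ⊔ B)
          (IntermediateField.subset_adjoin _ _ (by simp)))

end DelsarteSurface

end

/-! ### The three positions of the fourth exponent -/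

theorem mainTheorem4 {K : Type*} [Field K] [IsAlgClosed K] [CharZero K]
    (S : DelsarteSurface K) (hS : S.IsMinimal)
    {L : Type*} [Field L] [Algebra K L] (x y t : L) (hL : S.IsFunctionField x y t)
    (hgenus : 0 < geometricGenus (IntermediateField.adjoin K {t}) L) :
    ((∃ i : Fin 4, i ≠ 3 ∧ S.xyExponent 3 = S.xyExponent i) ∧ IsIsotrivial K t) ∨
    (∃ (S' : DelsarteSurface K) (a b c d : ℕ),
      0 < a ∧ b ≠ c ∧ b ≠ d ∧ c ≠ d ∧
      S'.affineEquation =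
        MvPolynomial.X 1 ^ a +
          (MvPolynomial.X 0 ^ b + MvPolynomial.X 0 ^ c
            + MvPolynomial.X 2 * MvPolynomial.X 0 ^ d) ∧
      S.IsDelsarteBirational S') ∨
    (∃ (n : ℕ) (A : Fin n → Subalgebra K L),
      IsProperModel t A ∧ MapsToPlaneCurves x y A ∧
        ∀ t₀ : K, t₀ ≠ 0 → HasSemistableFiber t A t₀) := by
  by_cases heq : ∃ i : Fin 4, i ≠ 3 ∧ S.xyExponent 3 = S.xyExponent i
  · refine .inl ⟨heq, ?_⟩
    obtain ⟨i, hi, h⟩ := heq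
    simp only [DelsarteSurface.xyExponent, Prod.mk.injEq] at h
    have hcross := DelsarteSurface.latticeCross_ne_zero hS
    fin_cases i
    · exact hL.isIsotrivial hS (i := 0) (j := 1) (k := 2) (by decide) (by decide) (by decide)
        (fun F => Fin.sum_univ_four F) (fun F => Fin.sum_univ_four F) h.1 h.2 hcross
    · refine hL.isIsotrivial hS (i := 1) (j := 0) (k := 2) (by decide) (by decide) (by decide)
        (fun F => by rw [Fin.sum_univ_four]; ring) (fun F => by rw [Fin.sum_univ_four]; ring)
        h.1 h.2 fun h' => hcross ?_
      simp only [latticeCross] at h' ⊢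
      linear_combination -h'
    · refine hL.isIsotrivial hS (i := 2) (j := 0) (k := 1) (by decide) (by decide) (by decide)
        (fun F => by rw [Fin.sum_univ_four]; ring) (fun F => by rw [Fin.sum_univ_four]; ring)
        h.1 h.2 fun h' => hcross ?_
      simp only [latticeCross] at h' ⊢
      linear_combination h'
    · exact absurd rfl hi
  by_cases hgen : InGeneralPosition S.latticePoint
  · refine .inr (.inr (exists_semistable_model (hL.x_ne_zero hS) (hL.y_ne_zero hS)
      (hL.t_ne_zero hS) hL.adjoin_eq_top S.latticePoint hgen ?_))
    have := hL.aeval_eq_zero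
    rw [DelsarteSurface.aeval_affineEquation hS] at this
    simpa [DelsarteSurface.latticePoint] using this
  · refine .inr (.inl (DelsarteSurface.exists_superelliptic hS (fun i hi h => heq ⟨i, hi, ?_⟩) hgen))
    exact DelsarteSurface.latticePoint_inj h
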